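/- Let $n\ge 2$, let $w\in S_n$ be the permutation with one-line notation $1\,n\,n-1\cdots 2$, and let $P_n$ be the path on $[n]$. For a graph $G$ on $[n]$, let $\mathcal{P}(G)\subset\mathbb{R}^n$ be the convex hull of $0$ and of all positive roots $e_i-e_j$ ($1\le i<j\le n$) that lie in the cone generated by the vectors $e_i-e_j$ with $(i,j)\in E(G)$, $i<j$. A graph on $[n]$ is noncrossing if it has no edges $(i,k),(j,l)$ with $i<j<k<l$, and alternating if it has no edges $(i,j),(j,k)$ with $i<j<k$. A vertex figure of a polytope at a vertex $v$ is its intersection with a hyperplane that has $v$ strictly on one side and all other vertices strictly on the other side. A pipe dream is a filling of the boxes $(r,c)$, $r,c\ge 1$, $r+c\le n$, with crosses and elbows (all further positions carry elbows). An elbow joins the left side of its box to the top and the bottom to the right; a cross joins left to right and bottom to top. It is a reduced pipe dream of $w$ if for each $i$ the pipe entering row $i$ from the left leaves at the top of column $w(i)$, and two pipes cross at most once. Put the simple reflection $s_{r+c-1}$ in box $(r,c)$; reading the rows from top to bottom, each from right to left, gives the triangular word $s_{n-1},\ldots,s_1,s_{n-1},\ldots,s_2,\ldots,s_{n-1},s_{n-2},s_{n-1}$.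 The pipe dream complex $PD(w)$ is the simplicial complex on the set of boxes whose faces are the sets $F$ such that some subword of the word on the complement of $F$ is a reduced decomposition of $w$. For a set $F$ of boxes let $G_F$ be the graph on $[n]$ with edges $(i,j)$, $i<j$, such that $(n-j+1,i)\in F$; for a pipe dream $P$ let $G(P)=G_{\mathrm{elbows}(P)}$. Theorem. The polytope $\mathcal{P}(P_n)$ has a vertex figure at $0$. Let $\mathcal{V}$ be any such vertex figure. Then: 1. The faces of the sets $\mathcal{P}(T)\cap\mathcal{V}$, where $T$ runs over the noncrossing alternating spanning trees of $K_n$, form a triangulation of $\mathcal{V}$ (the canonical triangulation). All its maximal simplices have dimension $n-2$, and $T\mapsto\mathcal{P}(T)\cap\mathcal{V}$ is a bijection from these trees onto the maximal simplices. 2. Taking the set of elbows is a bijection from the reduced pipe dreams of $w$ onto the maximal faces of $PD(w)$, and $P\mapsto G(P)$ is a bijection from the reduced pipe dreams of $w$ onto the noncrossing alternating spanning trees of $K_n$. 3. The canonical triangulation is a geometric realization of $PD(w)$: there is a map $\varphi$ from the set of boxes to $\mathbb{R}^n$, injective on the vertices of $PD(w)$, such that the vertex sets of the simplices of the canonical triangulation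 are exactly the sets $\varphi(F)$ with $F$ a nonempty face of $PD(w)$. It can be chosen such that $\mathrm{conv}\,\varphi(F)=\mathcal{P}(G_F)\cap\mathcal{V}$ for every nonempty face $F$ of $PD(w)$, and such that for any reduced pipe dreams $P_1,\ldots,P_l$ of $w$ ($l\ge 1$), if $P$ is the pipe dream whose crosses are all the crosses of $P_1,\ldots,P_l$, then $G(P)=G(P_1)\cap\cdots\cap G(P_l)$ and $$\mathcal{P}(G(P_1))\cap\cdots\cap\mathcal{P}(G(P_l))\cap\mathcal{V}=\mathcal{P}(G(P_1)\cap\cdots\cap G(P_l))\cap\mathcal{V}=\mathrm{conv}\,\varphi(\mathrm{elbows}(P)).$$ -/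

import Mathlib

/-!
Conventions. The vertex set `[n]` is `Fin n` (so the usual vertex `i` is `i - 1` here), the
coordinates of `ℝⁿ` are indexed by `Fin n`, and rows and columns of the triangular table are
counted from `0` as well.
-/

namespace PipeRoot

/-! ### Permutations, the triangular word and the pipe dream complex -/

/-- The simple reflection exchanging `k` and `k + 1`. -/
def simpleReflection {n : ℕ} (k : Fin (n - 1)) : Equiv.Perm (Fin n) :=
  Equiv.swap ⟨k, by omega⟩ ⟨k + 1, by omega⟩

/-- `L` is a reduced decomposition of `w`: the ordered product of the simple reflections listed in
`L` is `w`, and no shorter list of simple reflections has this property. -/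
def IsReducedDecomposition {n : ℕ} (L : List (Fin (n - 1))) (w : Equiv.Perm (Fin n)) : Prop :=
  (L.map simpleReflection).prod = w ∧
    ∀ L' : List (Fin (n - 1)), (L'.map simpleReflection).prod = w → L.length ≤ L'.length

/-- The boxes `(row, column)` of the triangular table of size `n`: row `r` (counted from `0`) has
`n - 1 - r` boxes. -/
abbrev Box (n : ℕ) : Type :=
  {b : Fin n × Fin n // b.1.val + b.2.val + 1 < n}

/-- The row of a box. -/
def Box.row {n : ℕ} (b : Box n) : ℕ := b.1.1.val

/-- The column of a box. -/
def Box.col {n : ℕ} (b : Box n) : ℕ := b.1.2.val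

/-- The simple reflection written in a box. -/
def Box.letter {n : ℕ} (b : Box n) : Fin (n - 1) :=
  ⟨b.row + b.col, by have h := b.2; unfold Box.row Box.col; omega⟩

/-- All boxes in reading order: rows from top to bottom, each row from right to left. Reading the
letters of the boxes in this order gives the triangular word
`s_{n-1}, …, s_1, s_{n-1}, …, s_2, …, s_{n-1}, s_{n-2}, s_{n-1}`, so that the subwords of this word
are the sets of boxes. -/
def readingOrder (n : ℕ) : List (Box n) :=
  (List.finRange n).flatMap fun r =>
    (List.finRange n).reverse.filterMap fun c =>
      if h : r.val + c.val + 1 < n then some ⟨(r, c), h⟩ else none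

/-- The word obtained by reading only the boxes in `R`. -/
def subword {n : ℕ} (R : Finset (Box n)) : List (Fin (n - 1)) :=
  ((readingOrder n).filter (fun b => b ∈ R)).map Box.letter

/-- The subword at the boxes in `R` contains `w`: some subsequence of it represents `w`. -/
def ContainsPerm {n : ℕ} (R : Finset (Box n)) (w : Equiv.Perm (Fin n)) : Prop :=
  ∃ R' ⊆ R, IsReducedDecomposition (subword R') w

theorem ContainsPerm.mono {n : ℕ} {R S : Finset (Box n)} {w : Equiv.Perm (Fin n)} (h : R ⊆ S)
    (hR : ContainsPerm R w) : ContainsPerm S w := by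
  obtain ⟨R', h1, h2⟩ := hR
  exact ⟨R', h1.trans h, h2⟩

/-- The pipe dream complex of `w`: its faces are the (nonempty) subwords of the triangular word
whose complement contains `w`. As usual in Mathlib, the empty face is not listed. -/
def pipeDreamComplex {n : ℕ} (w : Equiv.Perm (Fin n)) : PreAbstractSimplicialComplex (Box n) where
  faces := {F | F.Nonempty ∧ ContainsPerm Fᶜ w}
  isRelLowerSet_faces := by
    intro F hF
    refine ⟨hF.1, fun F' hle hne => ⟨hne, ?_⟩⟩
    exact ContainsPerm.mono (Finset.compl_subset_compl.mpr hle) hF.2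

/-- The permutation with one-line notation `1 n n-1 ⋯ 2`. -/
def permOneRev (n : ℕ) : Equiv.Perm (Fin n) :=
  Function.Involutive.toPerm
    (fun k => if h : k.val = 0 then k else ⟨n - k.val, by have hk := k.2; omega⟩)
    (by
      intro k
      have hk := k.2
      by_cases h : k.val = 0
      · simp [h]
      · have h2 : n - k.val ≠ 0 := by omega
        ext
        simp only [h, h2, dif_neg, not_false_eq_true]
        omega)

/-! ### Reduced pipe dreams -/

/-- The position `(r, c)` of the (infinite) table holds a cross. -/
def HasCross {n : ℕ} (C : Finset (Box n)) (r c : ℕ) : Prop :=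
  ∃ b ∈ C, b.row = r ∧ b.col = c

/-- The two sides through which a pipe can enter a tile. -/
inductive Side
  | left
  | bottom

/-- `PipeEnters C i r c s`: in the table with crosses at `C` and elbows at all other positions, the
pipe that starts at the left end of row `i` enters the tile at `(r, c)` through its side `s`.
A cross joins left to right and bottom to top; an elbow joins left to top and bottom to right. -/
inductive PipeEnters {n : ℕ} (C : Finset (Box n)) (i : ℕ) : ℕ → ℕ → Side → Prop
  | start : PipeEnters C i i 0 Side.left
  | crossRight {r c : ℕ} : PipeEnters C i r c Side.left → HasCross C r c →
      PipeEnters C i r (c + 1) Side.left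
  | elbowRight {r c : ℕ} : PipeEnters C i r c Side.bottom → ¬ HasCross C r c →
      PipeEnters C i r (c + 1) Side.left
  | crossUp {r c : ℕ} : PipeEnters C i (r + 1) c Side.bottom → HasCross C (r + 1) c →
      PipeEnters C i r c Side.bottom
  | elbowUp {r c : ℕ} : PipeEnters C i (r + 1) c Side.left → ¬ HasCross C (r + 1) c →
      PipeEnters C i r c Side.bottom

/-- The pipe that starts at row `i` leaves the table at the top of column `c`. -/
def PipeExits {n : ℕ} (C : Finset (Box n)) (i c : ℕ) : Prop :=
  (PipeEnters C i 0 c Side.bottom ∧ HasCross C 0 c) ∨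
    (PipeEnters C i 0 c Side.left ∧ ¬ HasCross C 0 c)

/-- The pipes `i` and `j` cross in the box `b`. -/
def PipesCrossAt {n : ℕ} (C : Finset (Box n)) (i j : ℕ) (b : Box n) : Prop :=
  b ∈ C ∧ (∃ s, PipeEnters C i b.row b.col s) ∧ ∃ s, PipeEnters C j b.row b.col s

/-- The pipe dream with set of crosses `C` (and elbows in the other boxes) is a reduced pipe dream
of `w`: the pipes intertwine according to `w`, and two pipes cross at most once. -/
def IsReducedPipeDream {n : ℕ} (w : Equiv.Perm (Fin n)) (C : Finset (Box n)) : Prop :=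
  (∀ i : Fin n, PipeExits C i (w i)) ∧
    ∀ i j : Fin n, i ≠ j → ∀ b b' : Box n,
      PipesCrossAt C i j b → PipesCrossAt C i j b' → b = b'

/-! ### Graphs -/

/-- No vertices `i < j < k < l` such that `(i, k)` and `(j, l)` are edges. -/
def IsNoncrossing {n : ℕ} (G : SimpleGraph (Fin n)) : Prop :=
  ¬ ∃ i j k l : Fin n, i < j ∧ j < k ∧ k < l ∧ G.Adj i k ∧ G.Adj j l

/-- No vertices `i < j < k` such that `(i, j)` and `(j, k)` are edges. -/
def IsAlternating {n : ℕ} (G : SimpleGraph (Fin n)) : Prop :=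
  ¬ ∃ i j k : Fin n, i < j ∧ j < k ∧ G.Adj i j ∧ G.Adj j k

/-- The noncrossing alternating spanning trees of `K_n`. -/
def ncAltTrees (n : ℕ) : Set (SimpleGraph (Fin n)) :=
  {T | T.IsTree ∧ IsNoncrossing T ∧ IsAlternating T}

/-- The box attached to the edge `(i, j)`, `i < j`; counting from `1` it is `(n - j + 1, i)`. -/
def edgeBox {n : ℕ} {i j : Fin n} (h : i < j) : Box n :=
  ⟨(⟨n - 1 - j.val, by omega⟩, i), by have h' : i.val < j.val := h; simp only; omega⟩

/-- The graph on `[n]` whose edges are the pairs attached to the boxes in `F`. -/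
def boxGraph {n : ℕ} (F : Finset (Box n)) : SimpleGraph (Fin n) :=
  SimpleGraph.fromRel fun i j => ∃ h : i < j, edgeBox h ∈ F

/-- The graph `G(P)` of the pipe dream with set of crosses `C`: its edges are the pairs attached to
the elbows. -/
def elbowGraph {n : ℕ} (C : Finset (Box n)) : SimpleGraph (Fin n) := boxGraph Cᶜ

/-! ### Root polytopes and vertex figures -/

/-- The vector `e_i - e_j`. -/
def root {n : ℕ} (i j : Fin n) : Fin n → ℝ := Pi.single i 1 - Pi.single j 1

/-- The positive roots `e_i - e_j`, `i < j`. -/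
def positiveRoots (n : ℕ) : Set (Fin n → ℝ) :=
  {x | ∃ i j : Fin n, i < j ∧ x = root i j}

/-- The cone generated by the vectors `e_i - e_j`, for the edges `(i, j)` of `G` with `i < j`. -/
def rootCone {n : ℕ} (G : SimpleGraph (Fin n)) : PointedCone ℝ (Fin n → ℝ) :=
  Submodule.span _ {x | ∃ i j : Fin n, i < j ∧ G.Adj i j ∧ x = root i j}

/-- The root polytope of `G`: the convex hull of `0` and of the positive roots in the cone
of `G`. -/
def rootPolytope {n : ℕ} (G : SimpleGraph (Fin n)) : Set (Fin n → ℝ) :=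
  convexHull ℝ (insert 0 (positiveRoots n ∩ (rootCone G : Set (Fin n → ℝ))))

/-- `V` is a vertex figure of the polytope `P` at its vertex `v`: the intersection of `P` with a
hyperplane that has `v` strictly on one side and all other vertices strictly on the other side. -/
def IsVertexFigure {E : Type*} [AddCommGroup E] [Module ℝ E] (P : Set E) (v : E) (V : Set E) :
    Prop :=
  v ∈ P.extremePoints ℝ ∧ ∃ (f : Module.Dual ℝ E) (b : ℝ), f ≠ 0 ∧ f v < b ∧
    (∀ u ∈ P.extremePoints ℝ, u ≠ v → b < f u) ∧ V = P ∩ {x | f x = b}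

/-- The simplices (given by their vertex sets) of the canonical triangulation of the vertex figure
`V`: all nonempty faces of the simplices `𝒫(T) ∩ V`, where `T` runs over the noncrossing
alternating spanning trees. -/
def canonicalFaces {n : ℕ} (V : Set (Fin n → ℝ)) : Set (Finset (Fin n → ℝ)) :=
  {s | s.Nonempty ∧ ∃ T ∈ ncAltTrees n,
    (s : Set (Fin n → ℝ)) ⊆ (rootPolytope T ∩ V).extremePoints ℝ}

/-- `φ` exhibits the geometric simplicial complex `K` as a geometric realization of the abstract
simplicial complex `Δ`: it is injective on the vertices of `Δ`, and the vertex sets of the simplices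
of `K` are exactly the images of the faces of `Δ`. -/
def IsGeometricRealization {α E : Type*} [AddCommGroup E] [Module ℝ E]
    (K : Geometry.SimplicialComplex ℝ E) (Δ : PreAbstractSimplicialComplex α) (φ : α → E) : Prop :=
  Set.InjOn φ {v | {v} ∈ Δ.faces} ∧
    ∀ s : Finset E, s ∈ K.faces ↔ ∃ F ∈ Δ.faces, (s : Set E) = φ '' (F : Set α)

end PipeRoot

/-!
Boxes are identified with edges: the box in row `r` and column `i` is the edge `(i, j)` with
`j = n - 1 - r` (counting from `0`). Everything rests on one combinatorial notion, the noncrossing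
alternating set of boxes `IsNCAlt`: there are no edges `(i, k)`, `(j, l)` with `i < j ≤ k < l`. The
maximal such sets are exactly the noncrossing alternating spanning trees (`maximal_isNCAlt_iff`): by
maximality, the gap between `j` and `j + 1` lies under an edge joining the far left neighbour of `j`
to the far right neighbour of `j + 1` (`edgeBox_mem_of_maximal`), which makes the graph connected,
and linear independence of the roots bounds the number of edges.

*Geometry.* All positive roots lie strictly beyond the hyperplane `f = β` that cuts out `V`, so `V`
is a slice of the cone of all positive roots, and `𝒫(G) ∩ V` is the convex hull of the points
`slicePoint` in which the rays of the edges of `G` meet the hyperplane (`rootPolytope_inter_eq`).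
Hence it suffices that each point of the cone is a nonnegative combination of roots with noncrossing
alternating support in exactly one way. Existence (`exists_rootComb_eq`) is the matching of
brackets; for uniqueness (`rootComb_unique`), a shortest edge where two combinations differ produces
a crossing. Uniqueness gives affine independence and the intersection property.

*Pipe dreams.* Tracing pipes computes the product of the subword at the crosses
(`pipeExits_prod_subword`). If the pipes realize `1 n n-1 ⋯ 2`, then counting pipes through the
right side of a rectangle shows that the elbows are noncrossing alternating
(`isNCAlt_compl_of_pipeExits`). Conversely, the pipes of a maximal noncrossing alternating set are
explicit and realize this permutation (`pipeExits_of_maximal`). The complement of such a set has as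
many boxes as the permutation has inversions, which makes the word and the pipe dream reduced. So
the nonempty noncrossing alternating sets are the faces of the pipe dream complex
(`containsPerm_compl_iff`), and the maximal ones are the sets of elbows of the reduced pipe dreams
(`isReducedPipeDream_iff`).
-/

namespace PipeRoot

/-! ### Boxes as edges of the complete graph -/

/-- The smaller endpoint of the edge attached to a box. -/
def Box.src {n : ℕ} (b : Box n) : Fin n := b.1.2

/-- The larger endpoint of the edge attached to a box. -/
def Box.tgt {n : ℕ} (b : Box n) : Fin n := ⟨n - 1 - b.row, by have := b.1.1.2; omega⟩

theorem Box.src_lt_tgt {n : ℕ} (b : Box n) : b.src < b.tgt := by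
  have h := b.2
  change b.1.2.val < n - 1 - b.1.1.val
  omega

theorem Box.src_val {n : ℕ} (b : Box n) : b.src.val = b.col := rfl

theorem Box.tgt_val {n : ℕ} (b : Box n) : b.tgt.val = n - 1 - b.row := rfl

theorem Box.row_add_col_lt {n : ℕ} (b : Box n) : b.row + b.col + 1 < n := b.2

theorem Box.ext_row_col {n : ℕ} {b b' : Box n} (h : b.row = b'.row) (h' : b.col = b'.col) :
    b = b' :=
  Subtype.ext (Prod.ext (Fin.ext h) (Fin.ext h'))

theorem Box.ext_src_tgt {n : ℕ} {b b' : Box n} (h : b.src = b'.src) (h' : b.tgt = b'.tgt) :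
    b = b' := by
  have h1 := congrArg Fin.val h
  have h2 := congrArg Fin.val h'
  have h3 := b.row_add_col_lt
  have h4 := b'.row_add_col_lt
  rw [Box.tgt_val, Box.tgt_val] at h2
  exact Box.ext_row_col (by omega) h1

@[simp] theorem edgeBox_src {n : ℕ} {i j : Fin n} (h : i < j) : (edgeBox h).src = i := rfl

@[simp] theorem edgeBox_tgt {n : ℕ} {i j : Fin n} (h : i < j) : (edgeBox h).tgt = j := by
  ext
  have := j.2
  change n - 1 - (n - 1 - j.val) = j.val
  omega

@[simp] theorem edgeBox_src_tgt {n : ℕ} (b : Box n) : edgeBox b.src_lt_tgt = b :=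
  Box.ext_src_tgt (by simp) (by simp)

theorem boxGraph_adj {n : ℕ} {F : Finset (Box n)} {i j : Fin n} :
    (boxGraph F).Adj i j ↔ ∃ b ∈ F, (b.src = i ∧ b.tgt = j) ∨ (b.src = j ∧ b.tgt = i) := by
  rw [boxGraph, SimpleGraph.fromRel_adj]
  constructor
  · rintro ⟨-, ⟨h, hb⟩ | ⟨h, hb⟩⟩
    · exact ⟨_, hb, Or.inl (by simp)⟩
    · exact ⟨_, hb, Or.inr (by simp)⟩
  · rintro ⟨b, hb, ⟨rfl, rfl⟩ | ⟨rfl, rfl⟩⟩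
    · exact ⟨b.src_lt_tgt.ne, Or.inl ⟨b.src_lt_tgt, by simpa⟩⟩
    · exact ⟨b.src_lt_tgt.ne', Or.inr ⟨b.src_lt_tgt, by simpa⟩⟩

theorem boxGraph_adj_src_tgt {n : ℕ} {F : Finset (Box n)} (b : Box n) :
    (boxGraph F).Adj b.src b.tgt ↔ b ∈ F := by
  rw [boxGraph_adj]
  constructor
  · rintro ⟨b', hb', ⟨h1, h2⟩ | ⟨h1, h2⟩⟩
    · rwa [← Box.ext_src_tgt h1 h2]
    · have h3 := b'.src_lt_tgt
      rw [h1, h2] at h3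
      exact absurd h3 b.src_lt_tgt.not_gt
  · exact fun hb => ⟨b, hb, Or.inl ⟨rfl, rfl⟩⟩

theorem boxGraph_adj_of_lt {n : ℕ} {F : Finset (Box n)} {i j : Fin n} (h : i < j) :
    (boxGraph F).Adj i j ↔ edgeBox h ∈ F := by
  simpa using boxGraph_adj_src_tgt (F := F) (edgeBox h)

theorem boxGraph_injective {n : ℕ} : Function.Injective (boxGraph (n := n)) := by
  intro F F' h
  ext b
  rw [← boxGraph_adj_src_tgt, ← boxGraph_adj_src_tgt, h]

open Classical in
/-- The boxes attached to the edges of a graph on `[n]`. -/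
noncomputable def graphBoxes {n : ℕ} (G : SimpleGraph (Fin n)) : Finset (Box n) :=
  Finset.univ.filter fun b => G.Adj b.src b.tgt

theorem mem_graphBoxes {n : ℕ} {G : SimpleGraph (Fin n)} {b : Box n} :
    b ∈ graphBoxes G ↔ G.Adj b.src b.tgt := by
  simp [graphBoxes]

@[simp] theorem boxGraph_graphBoxes {n : ℕ} (G : SimpleGraph (Fin n)) :
    boxGraph (graphBoxes G) = G := by
  have key : ∀ i j : Fin n, i < j → ((boxGraph (graphBoxes G)).Adj i j ↔ G.Adj i j) := by
    intro i j h
    rw [boxGraph_adj_of_lt h, mem_graphBoxes, edgeBox_src, edgeBox_tgt]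
  ext i j
  rcases lt_trichotomy i j with h | rfl | h
  · exact key i j h
  · simp
  · rw [SimpleGraph.adj_comm, key j i h, SimpleGraph.adj_comm]

theorem card_eq_ncard_edgeSet {n : ℕ} (F : Finset (Box n)) :
    F.card = (boxGraph F).edgeSet.ncard := by
  rw [← Set.ncard_coe_finset]
  refine Set.ncard_congr (fun b _ => s(b.src, b.tgt)) ?_ ?_ ?_
  · intro b hb
    rw [SimpleGraph.mem_edgeSet]
    exact (boxGraph_adj_src_tgt b).2 hb
  · intro b b' _ _ h
    rcases Sym2.eq_iff.1 h with ⟨h1, h2⟩ | ⟨h1, h2⟩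
    · exact Box.ext_src_tgt h1 h2
    · have := b.src_lt_tgt
      rw [h1, h2] at this
      exact absurd this b'.src_lt_tgt.not_gt
  · intro e he
    induction e with
    | h i j =>
      rw [SimpleGraph.mem_edgeSet, boxGraph_adj] at he
      obtain ⟨b, hb, ⟨rfl, rfl⟩ | ⟨rfl, rfl⟩⟩ := he
      · exact ⟨b, hb, rfl⟩
      · exact ⟨b, hb, Sym2.eq_swap⟩

theorem elbowGraph_biUnion {n : ℕ} (S : Finset (Finset (Box n))) (hS : S.Nonempty) :
    elbowGraph (S.biUnion id) = ⨅ C ∈ S, elbowGraph C := by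
  obtain ⟨C₀, hC₀⟩ := hS
  have key : ∀ i j : Fin n, i < j →
      ((elbowGraph (S.biUnion id)).Adj i j ↔ (⨅ C ∈ S, elbowGraph C).Adj i j) := by
    intro i j h
    simp only [elbowGraph, SimpleGraph.iInf_adj, boxGraph_adj_of_lt h, Finset.mem_compl,
      Finset.mem_biUnion, id]
    constructor
    · intro h'
      refine ⟨fun C => ⟨fun hC hb => h' ⟨C, hC, hb⟩, h.ne⟩, h.ne⟩
    · rintro ⟨h', -⟩ ⟨C, hC, hb⟩
      exact (h' C).1 hC hb
  ext i j
  rcases lt_trichotomy i j with h | rfl | h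
  · exact key i j h
  · simp
  · rw [SimpleGraph.adj_comm, key j i h, SimpleGraph.adj_comm]

/-! ### Noncrossing alternating sets of boxes -/

/-- A set of boxes is noncrossing alternating if the attached graph has no edges `(i, k)`, `(j, l)`
with `i < j ≤ k < l`. The strict inequality `j < k` excludes crossings and the equality `j = k`
excludes increasing paths. In the table, no elbow lies strictly to the north-east of another elbow
when the south-east corner of the rectangle they span is in the table or on its diagonal. -/
def IsNCAlt {n : ℕ} (F : Finset (Box n)) : Prop :=
  ∀ b ∈ F, ∀ b' ∈ F, b.src < b'.src → b'.src ≤ b.tgt → ¬ b.tgt < b'.tgt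

theorem IsNCAlt.mono {n : ℕ} {F F' : Finset (Box n)} (h : IsNCAlt F') (hF : F ⊆ F') : IsNCAlt F :=
  fun b hb b' hb' => h b (hF hb) b' (hF hb')

theorem isNCAlt_iff {n : ℕ} {F : Finset (Box n)} :
    IsNCAlt F ↔ IsNoncrossing (boxGraph F) ∧ IsAlternating (boxGraph F) := by
  constructor
  · intro h
    constructor
    · rintro ⟨i, j, k, l, hij, hjk, hkl, h1, h2⟩
      rw [boxGraph_adj_of_lt (hij.trans hjk)] at h1
      rw [boxGraph_adj_of_lt (hjk.trans hkl)] at h2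
      exact h _ h1 _ h2 (by simpa) (by simpa using hjk.le) (by simpa)
    · rintro ⟨i, j, k, hij, hjk, h1, h2⟩
      rw [boxGraph_adj_of_lt hij] at h1
      rw [boxGraph_adj_of_lt hjk] at h2
      exact h _ h1 _ h2 (by simpa) (by simp) (by simpa)
  · rintro ⟨h1, h2⟩ b hb b' hb' h3 h4 h5
    have e1 := (boxGraph_adj_src_tgt b).2 hb
    have e2 := (boxGraph_adj_src_tgt b').2 hb'
    rcases h4.eq_or_lt with h4 | h4
    · rw [h4] at e2
      exact h2 ⟨_, _, _, b.src_lt_tgt, h5, e1, e2⟩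
    · exact h1 ⟨_, _, _, _, h3, h4, h5, e1, e2⟩

theorem isNCAlt_singleton {n : ℕ} (b : Box n) : IsNCAlt {b} := by
  intro c hc c' hc' h
  rw [Finset.mem_singleton] at hc hc'
  subst hc hc'
  exact absurd h (lt_irrefl _)

theorem IsNCAlt.exists_maximal {n : ℕ} {F : Finset (Box n)} (h : IsNCAlt F) :
    ∃ M, F ⊆ M ∧ Maximal IsNCAlt M :=
  (Set.toFinite {F : Finset (Box n) | IsNCAlt F}).exists_le_maximal h

/-- `c` is the smallest neighbour of `j` to its left, or `j` itself if there is none. -/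
structure IsLeftEnd {n : ℕ} (F : Finset (Box n)) (j c : Fin n) : Prop where
  le : c ≤ j
  mem : ∀ h : c < j, edgeBox h ∈ F
  min : ∀ b ∈ F, b.tgt = j → c ≤ b.src

/-- `d` is the largest neighbour of `j` to its right, or `j` itself if there is none. -/
structure IsRightEnd {n : ℕ} (F : Finset (Box n)) (j d : Fin n) : Prop where
  le : j ≤ d
  mem : ∀ h : j < d, edgeBox h ∈ F
  max : ∀ b ∈ F, b.src = j → b.tgt ≤ d

theorem exists_isLeftEnd {n : ℕ} (F : Finset (Box n)) (j : Fin n) : ∃ c, IsLeftEnd F j c := by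
  classical
  obtain ⟨c, hc, hmin⟩ := (insert j ((F.filter fun b => b.tgt = j).image Box.src)).exists_min_image
    id (Finset.insert_nonempty _ _)
  simp only [Finset.mem_insert, Finset.mem_image, Finset.mem_filter, id] at hc hmin
  refine ⟨c, hmin j (Or.inl rfl), fun h => ?_,
    fun b hb hbj => hmin _ (Or.inr ⟨b, ⟨hb, hbj⟩, rfl⟩)⟩
  rcases hc with rfl | ⟨b, ⟨hb, rfl⟩, rfl⟩
  · exact absurd h (lt_irrefl _)
  · simpa

theorem exists_isRightEnd {n : ℕ} (F : Finset (Box n)) (j : Fin n) : ∃ d, IsRightEnd F j d := by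
  classical
  obtain ⟨d, hd, hmax⟩ := (insert j ((F.filter fun b => b.src = j).image Box.tgt)).exists_max_image
    id (Finset.insert_nonempty _ _)
  simp only [Finset.mem_insert, Finset.mem_image, Finset.mem_filter, id] at hd hmax
  refine ⟨d, hmax j (Or.inl rfl), fun h => ?_,
    fun b hb hbj => hmax _ (Or.inr ⟨b, ⟨hb, hbj⟩, rfl⟩)⟩
  rcases hd with rfl | ⟨b, ⟨hb, rfl⟩, rfl⟩
  · exact absurd h (lt_irrefl _)
  · simpa

/-- In a maximal noncrossing alternating set every gap between consecutive vertices `j` and `k` lies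
under an edge that joins the far left neighbour of `j` to the far right neighbour of `k`: this edge
is compatible with all others. -/
theorem edgeBox_mem_of_maximal {n : ℕ} {F : Finset (Box n)} (hF : Maximal IsNCAlt F)
    {j k c d : Fin n} (hjk : j.val + 1 = k.val) (hc : IsLeftEnd F j c) (hd : IsRightEnd F k d)
    (hcd : c < d) : edgeBox hcd ∈ F := by
  classical
  have hcj := hc.le
  have hkd := hd.le
  have hlt : j < k := Fin.lt_def.2 (by omega)
  have hsucc : ∀ y : Fin n, j < y → k ≤ y := fun y hy => by
    rw [Fin.lt_def] at hy; rw [Fin.le_def]; omega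
  -- an edge `(x, y)` with `x < c ≤ y < d` would conflict with the edge `(c, j)` or `(k, d)`
  have h1 : ∀ b ∈ F, b.src < c → c ≤ b.tgt → ¬ b.tgt < d := by
    intro b hb hx hy hy'
    rcases lt_trichotomy b.tgt j with hyj | hyj | hyj
    · have hcj' : c < j := hy.trans_lt hyj
      exact hF.1 b hb _ (hc.mem hcj') (by simpa) (by simpa) (by simpa)
    · exact (hc.min b hb hyj).not_gt hx
    · have hky := hsucc _ hyj
      have hkd' : k < d := hky.trans_lt hy'
      exact hF.1 b hb _ (hd.mem hkd') (by simpa using (hx.trans_le hcj).trans hlt)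
        (by simpa) (by simpa)
  have h2 : ∀ b ∈ F, c < b.src → b.src ≤ d → ¬ d < b.tgt := by
    intro b hb hx hx' hy
    rcases lt_trichotomy b.src k with hxk | hxk | hxk
    · have hxj : b.src ≤ j := not_lt.1 fun h => (hsucc _ h).not_gt hxk
      have hcj' : c < j := hx.trans_le hxj
      exact hF.1 _ (hc.mem hcj') b hb (by simpa) (by simpa)
        (by simpa using (hlt.trans_le hkd).trans hy)
    · exact (hd.max b hb hxk).not_gt hy
    · have hkd' : k < d := hxk.trans_le hx'
      exact hF.1 _ (hd.mem hkd') b hb (by simpa) (by simpa) (by simpa)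
  have h3 : IsNCAlt (insert (edgeBox hcd) F) := by
    intro b hb b' hb' e1 e2 e3
    rw [Finset.mem_insert] at hb hb'
    rcases hb with rfl | hb <;> rcases hb' with rfl | hb'
    · exact lt_irrefl _ e1
    · rw [edgeBox_src] at e1
      rw [edgeBox_tgt] at e2 e3
      exact h2 b' hb' e1 e2 e3
    · rw [edgeBox_src] at e1 e2
      rw [edgeBox_tgt] at e3
      exact h1 b hb e1 e2 e3
    · exact hF.1 b hb b' hb' e1 e2 e3
  exact hF.2 h3 (Finset.subset_insert _ _) (Finset.mem_insert_self _ _)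

theorem connected_of_maximal {n : ℕ} (hn : 0 < n) {F : Finset (Box n)} (hF : Maximal IsNCAlt F) :
    (boxGraph F).Connected := by
  have step : ∀ j k : Fin n, j.val + 1 = k.val → (boxGraph F).Reachable j k := by
    intro j k hjk
    obtain ⟨c, hc⟩ := exists_isLeftEnd F j
    obtain ⟨d, hd⟩ := exists_isRightEnd F k
    have hlt : j < k := Fin.lt_def.2 (by omega)
    have hcd : c < d := (hc.le.trans_lt hlt).trans_le hd.le
    have h1 : (boxGraph F).Reachable j c := by
      rcases hc.le.eq_or_lt with h | h
      · rw [h]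
      · exact ((boxGraph_adj_of_lt h).2 (hc.mem h)).symm.reachable
    have h2 : (boxGraph F).Reachable d k := by
      rcases hd.le.eq_or_lt with h | h
      · rw [h]
      · exact ((boxGraph_adj_of_lt h).2 (hd.mem h)).symm.reachable
    exact h1.trans
      (((boxGraph_adj_of_lt hcd).2 (edgeBox_mem_of_maximal hF hjk hc hd hcd)).reachable.trans h2)
  have h0 : ∀ m (hm : m < n), (boxGraph F).Reachable ⟨0, hn⟩ ⟨m, hm⟩ := by
    intro m
    induction m with
    | zero => exact fun _ => SimpleGraph.Reachable.refl _
    | succ m ih => exact fun hm => (ih (by omega)).trans (step ⟨m, by omega⟩ ⟨m + 1, hm⟩ rfl)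
  have : Nonempty (Fin n) := ⟨⟨0, hn⟩⟩
  exact ⟨fun i j => (h0 i i.2).symm.trans (h0 j j.2)⟩

/-! ### Nonnegative combinations of roots -/

/-- The linear combination of the positive roots with coefficients `a`, where the root `e_i - e_j`
is indexed by the box of the edge `(i, j)`. -/
noncomputable def rootComb {n : ℕ} (a : Box n → ℝ) : Fin n → ℝ := ∑ b, a b • root b.src b.tgt

theorem rootComb_apply {n : ℕ} (a : Box n → ℝ) (i : Fin n) :
    rootComb a i = ∑ b with b.src = i, a b - ∑ b with b.tgt = i, a b := by
  rw [rootComb, Finset.sum_apply, Finset.sum_filter, Finset.sum_filter, ← Finset.sum_sub_distrib]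
  refine Finset.sum_congr rfl fun b _ => ?_
  simp only [Pi.smul_apply, root, Pi.sub_apply, Pi.single_apply, smul_eq_mul, mul_sub, mul_ite,
    mul_one, mul_zero, eq_comm]

theorem rootComb_add {n : ℕ} (a a' : Box n → ℝ) :
    rootComb (a + a') = rootComb a + rootComb a' := by
  simp [rootComb, add_smul, Finset.sum_add_distrib]

theorem rootComb_sub {n : ℕ} (a a' : Box n → ℝ) :
    rootComb (a - a') = rootComb a - rootComb a' := by
  simp [rootComb, sub_smul, Finset.sum_sub_distrib]

theorem rootComb_smul {n : ℕ} (t : ℝ) (a : Box n → ℝ) : rootComb (t • a) = t • rootComb a := by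
  simp [rootComb, Finset.smul_sum, mul_smul]

theorem rootComb_single {n : ℕ} (b : Box n) (t : ℝ) :
    rootComb (Pi.single b t) = t • root b.src b.tgt := by
  rw [rootComb, Finset.sum_eq_single b]
  · simp
  · intro b' _ h
    simp [h]
  · simp

theorem map_rootComb {n : ℕ} (f : Module.Dual ℝ (Fin n → ℝ)) (a : Box n → ℝ) :
    f (rootComb a) = ∑ b, a b * f (root b.src b.tgt) := by
  simp [rootComb, map_sum]

theorem sum_root {n : ℕ} (i j : Fin n) : ∑ k, root i j k = 0 := by
  simp [root]

/-- A nonnegative combination of roots is determined by its value if its support is noncrossing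
alternating. At a shortest edge `(i, j)` where two coefficient families differ, comparing the
coordinates `i` and `j` produces longer edges `(i, l)` and `(k, j)` in one of the supports, and
these cross. -/
theorem rootComb_unique {n : ℕ} {F F' : Finset (Box n)} (hF : IsNCAlt F) (hF' : IsNCAlt F')
    {a a' : Box n → ℝ} (ha : ∀ b, 0 ≤ a b) (ha' : ∀ b, 0 ≤ a' b) (hs : ∀ b ∉ F, a b = 0)
    (hs' : ∀ b ∉ F', a' b = 0) (h : rootComb a = rootComb a') : a = a' := by
  classical
  by_contra hne
  have hD : (Finset.univ.filter fun b => a b ≠ a' b).Nonempty := by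
    obtain ⟨b, hb⟩ := Function.ne_iff.1 hne
    exact ⟨b, by simpa⟩
  obtain ⟨b, hb, hmin⟩ := Finset.exists_min_image _ (fun b => b.tgt.val - b.src.val) hD
  simp only [Finset.mem_filter, Finset.mem_univ, true_and] at hb hmin
  clear hD hne
  wlog hlt : a' b < a b generalizing F F' a a'
  · exact this hF' hF ha' ha hs' hs h.symm hb.symm (fun c hc => hmin c hc.symm)
      (lt_of_le_of_ne (not_lt.1 hlt) hb)
  have hbF : b ∈ F := by
    by_contra hbF
    rw [hs b hbF] at hlt
    exact (ha' b).not_gt hlt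
  have hbl := b.src_lt_tgt
  -- `b.src` is not the larger endpoint, and `b.tgt` is not the smaller endpoint, of an edge of `F`
  have z1 : ∑ c with c.tgt = b.src, a c = 0 := by
    refine Finset.sum_eq_zero fun c hc => hs c fun hcF => ?_
    rw [Finset.mem_filter] at hc
    exact hF c hcF b hbF (hc.2 ▸ c.src_lt_tgt) hc.2.ge (hc.2 ▸ hbl)
  have z2 : ∑ c with c.src = b.tgt, a c = 0 := by
    refine Finset.sum_eq_zero fun c hc => hs c fun hcF => ?_
    rw [Finset.mem_filter] at hc
    exact hF b hbF c hcF (hc.2 ▸ hbl) hc.2.le (hc.2 ▸ c.src_lt_tgt)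
  have p1 : 0 ≤ ∑ c with c.tgt = b.src, a' c := Finset.sum_nonneg fun c _ => ha' c
  have p2 : 0 ≤ ∑ c with c.src = b.tgt, a' c := Finset.sum_nonneg fun c _ => ha' c
  have e1 := congrFun h b.src
  have e2 := congrFun h b.tgt
  rw [rootComb_apply, rootComb_apply] at e1 e2
  have s1 : ∑ c with c.src = b.src, a c ≤ ∑ c with c.src = b.src, a' c := by linarith
  have s2 : ∑ c with c.tgt = b.tgt, a c ≤ ∑ c with c.tgt = b.tgt, a' c := by linarith
  have x1 : ∃ c, c.src = b.src ∧ a c < a' c := by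
    by_contra! hcon
    exact (Finset.sum_lt_sum (fun c hc => hcon c (Finset.mem_filter.1 hc).2)
      ⟨b, by simp, hlt⟩).not_ge s1
  have x2 : ∃ c, c.tgt = b.tgt ∧ a c < a' c := by
    by_contra! hcon
    exact (Finset.sum_lt_sum (fun c hc => hcon c (Finset.mem_filter.1 hc).2)
      ⟨b, by simp, hlt⟩).not_ge s2
  have hmem : ∀ c, a c < a' c → c ∈ F' := by
    intro c hc
    by_contra hcF
    rw [hs' c hcF] at hc
    exact (ha c).not_gt hc
  obtain ⟨c, hc, hca⟩ := x1
  obtain ⟨d, hd, hda⟩ := x2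
  have hc1 := hmin c hca.ne
  have hd1 := hmin d hda.ne
  have hcl := c.src_lt_tgt
  have hdl := d.src_lt_tgt
  have hcb : c.tgt ≠ b.tgt := fun h' => by
    rw [Box.ext_src_tgt hc h'] at hca
    exact hca.not_gt hlt
  have hdb : d.src ≠ b.src := fun h' => by
    rw [Box.ext_src_tgt h' hd] at hda
    exact hda.not_gt hlt
  rw [Fin.lt_def] at hbl hcl hdl
  rw [Ne, Fin.ext_iff] at hcb hdb
  rw [Fin.ext_iff] at hc hd
  refine hF' d (hmem d hda) c (hmem c hca) ?_ ?_ ?_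
  · rw [Fin.lt_def]; omega
  · rw [Fin.le_def]; omega
  · rw [Fin.lt_def]; omega

/-- The roots of a noncrossing alternating set are linearly independent: the positive and the
negative part of a relation have the same value. -/
theorem eq_zero_of_rootComb_eq_zero {n : ℕ} {F : Finset (Box n)} (hF : IsNCAlt F) {a : Box n → ℝ}
    (hs : ∀ b ∉ F, a b = 0) (h : rootComb a = 0) : a = 0 := by
  have h1 : (fun b => a b ⊔ 0) = fun b => (-a b) ⊔ 0 := by
    refine rootComb_unique hF hF (fun b => le_sup_right) (fun b => le_sup_right)
      (fun b hb => by simp [hs b hb]) (fun b hb => by simp [hs b hb]) ?_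
    rw [← sub_eq_zero, ← rootComb_sub, ← h]
    congr 1
    funext b
    exact posPart_sub_negPart (a b)
  funext b
  have h2 := congrFun h1 b
  rw [Pi.zero_apply]
  rcases le_total 0 (a b) with h3 | h3
  · simp only [sup_of_le_left h3, sup_of_le_right (neg_nonpos.2 h3)] at h2
    exact h2
  · simp only [sup_of_le_right h3, sup_of_le_left (neg_nonneg.2 h3)] at h2
    linarith

theorem IsNCAlt.linearIndependent {n : ℕ} {F : Finset (Box n)} (hF : IsNCAlt F) {t : Box n → ℝ}
    (ht : ∀ b, t b ≠ 0) : LinearIndependent ℝ (fun b : F => t b • root b.1.src b.1.tgt) := by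
  classical
  rw [Fintype.linearIndependent_iff]
  intro g hg b
  have h0 : (fun b => if h : b ∈ F then g ⟨b, h⟩ * t b else 0) = 0 := by
    refine eq_zero_of_rootComb_eq_zero hF (fun b hb => by simp [hb]) ?_
    rw [rootComb, ← hg, ← Finset.sum_subset (Finset.subset_univ F), ← Finset.sum_coe_sort F]
    · exact Finset.sum_congr rfl fun b _ => by simp [mul_smul]
    · intro b _ hb
      simp [hb]
  simpa [ht] using congrFun h0 b

theorem IsNCAlt.card_lt {n : ℕ} (hn : 0 < n) {F : Finset (Box n)} (hF : IsNCAlt F) :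
    F.card < n := by
  have hli := hF.linearIndependent (t := 1) (fun _ => one_ne_zero)
  simp only [Pi.one_apply, one_smul] at hli
  have hcard := finrank_span_eq_card hli
  rw [Fintype.card_coe] at hcard
  rw [← hcard]
  have hlt : Submodule.span ℝ (Set.range fun b : F => root b.1.src b.1.tgt) ≠ ⊤ := by
    intro htop
    have hle : Submodule.span ℝ (Set.range fun b : F => root b.1.src b.1.tgt) ≤
        LinearMap.ker (∑ k : Fin n, LinearMap.proj k : (Fin n → ℝ) →ₗ[ℝ] ℝ) := by
      rw [Submodule.span_le]
      rintro _ ⟨b, rfl⟩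
      simpa using sum_root b.1.src b.1.tgt
    rw [htop, top_le_iff] at hle
    have hmem : Pi.single ⟨0, hn⟩ 1 ∈
        LinearMap.ker (∑ k : Fin n, LinearMap.proj k : (Fin n → ℝ) →ₗ[ℝ] ℝ) := by
      rw [hle]; trivial
    simp at hmem
  simpa using Submodule.finrank_lt (lt_top_iff_ne_top.2 hlt).ne

/-- The noncrossing alternating spanning trees are the maximal noncrossing alternating graphs. -/
theorem maximal_isNCAlt_iff {n : ℕ} (hn : 0 < n) {F : Finset (Box n)} :
    Maximal IsNCAlt F ↔ boxGraph F ∈ ncAltTrees n := by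
  have hcard : ∀ {F : Finset (Box n)}, (boxGraph F).IsTree → F.card + 1 = n := by
    intro F h
    rw [card_eq_ncard_edgeSet]
    simpa [Set.ncard_def] using (SimpleGraph.isTree_iff_connected_and_card.1 h).2
  constructor
  · intro h
    refine ⟨?_, isNCAlt_iff.1 h.1⟩
    have hc := connected_of_maximal hn h
    obtain ⟨T, hT, hTt⟩ := hc.exists_isTree_le
    have h1 : graphBoxes T ⊆ F := fun b hb =>
      (boxGraph_adj_src_tgt b).1 (hT (mem_graphBoxes.1 hb))
    have h2 := hcard (F := graphBoxes T) (by rwa [boxGraph_graphBoxes])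
    have h3 := h.1.card_lt hn
    have h4 := Finset.eq_of_subset_of_card_le h1 (by omega)
    rwa [← h4, boxGraph_graphBoxes]
  · rintro ⟨h1, h2⟩
    refine ⟨isNCAlt_iff.2 h2, fun F' hF' hle => ?_⟩
    have h3 := hcard h1
    have h4 := hF'.card_lt hn
    exact (Finset.eq_of_subset_of_card_le hle (by omega)).ge

theorem card_of_maximal {n : ℕ} (hn : 0 < n) {F : Finset (Box n)} (h : Maximal IsNCAlt F) :
    F.card + 1 = n := by
  rw [card_eq_ncard_edgeSet]
  simpa [Set.ncard_def] using
    (SimpleGraph.isTree_iff_connected_and_card.1 ((maximal_isNCAlt_iff hn).1 h).1).2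

theorem rootComb_mem_hyperplane {n : ℕ} (a : Box n → ℝ) : ∑ k, rootComb a k = 0 := by
  simp_rw [rootComb, Finset.sum_apply]
  rw [Finset.sum_comm]
  refine Finset.sum_eq_zero fun b _ => ?_
  simp_rw [Pi.smul_apply, ← Finset.smul_sum, sum_root, smul_zero]

theorem sum_Iic_rootComb_nonneg {n : ℕ} {a : Box n → ℝ} (ha : ∀ b, 0 ≤ a b) (k : Fin n) :
    0 ≤ ∑ t ∈ Finset.Iic k, rootComb a t := by
  simp_rw [rootComb, Finset.sum_apply]
  rw [Finset.sum_comm]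
  refine Finset.sum_nonneg fun b _ => ?_
  simp_rw [Pi.smul_apply, ← Finset.smul_sum]
  refine mul_nonneg (ha b) ?_
  have := b.src_lt_tgt
  simp only [root, Pi.sub_apply, Finset.sum_sub_distrib, Finset.sum_pi_single', Finset.mem_Iic]
  by_cases h : b.tgt ≤ k
  · simp [h, this.le.trans h]
  · simp only [h, if_false]
    split_ifs <;> norm_num

/-- A vector with coordinate sum zero and nonnegative partial sums is a nonnegative combination of
roots with noncrossing alternating support. The first negative coordinate `j` is matched with the
last nonzero coordinate `i` before it, as in the matching of brackets; nothing is left between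
them. -/
theorem exists_rootComb_eq {n : ℕ} (x : Fin n → ℝ) (h0 : ∑ k, x k = 0)
    (hx : ∀ k, 0 ≤ ∑ t ∈ Finset.Iic k, x t) :
    ∃ (F : Finset (Box n)) (a : Box n → ℝ), IsNCAlt F ∧ (∀ b, 0 ≤ a b) ∧ (∀ b ∉ F, a b = 0) ∧
      (∀ b ∈ F, 0 < x b.src ∧ x b.tgt < 0) ∧ rootComb a = x := by
  classical
  induction hm : (Finset.univ.filter fun k => x k ≠ 0).card using Nat.strong_induction_on
    generalizing x with
  | _ m ih =>
  by_cases hneg : ∃ j, x j < 0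
  swap
  · push Not at hneg
    have hz : x = 0 := by
      funext k
      exact (Finset.sum_eq_zero_iff_of_nonneg (fun k _ => hneg k)).1 h0 k (Finset.mem_univ k)
    refine ⟨∅, 0, fun b hb => absurd hb (Finset.notMem_empty b), fun b => le_rfl, fun b _ => rfl,
      fun b hb => absurd hb (Finset.notMem_empty b), ?_⟩
    rw [hz]
    simp [rootComb]
  obtain ⟨j, hj, hjmin⟩ := Finset.exists_min_image (Finset.univ.filter fun j => x j < 0) id
    (by obtain ⟨j, hj⟩ := hneg; exact ⟨j, by simpa⟩)
  simp only [Finset.mem_filter, Finset.mem_univ, true_and, id] at hj hjmin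
  have hnn : ∀ t, t < j → 0 ≤ x t := fun t ht => not_lt.1 fun h => (hjmin t h).not_gt ht
  have hex : ∃ t, t < j ∧ x t ≠ 0 := by
    by_contra! hcon
    refine (hx j).not_gt ?_
    rw [Finset.sum_eq_single j]
    · exact hj
    · intro t ht htj
      exact hcon t (lt_of_le_of_ne (Finset.mem_Iic.1 ht) htj)
    · intro h
      exact absurd (Finset.mem_Iic.2 le_rfl) h
  obtain ⟨i, hi, himax⟩ := Finset.exists_max_image
    (Finset.univ.filter fun t => t < j ∧ x t ≠ 0) id
    (by obtain ⟨t, ht⟩ := hex; exact ⟨t, by simpa using ht⟩)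
  simp only [Finset.mem_filter, Finset.mem_univ, true_and, id] at hi himax
  obtain ⟨hij, hi0⟩ := hi
  have hipos : 0 < x i := lt_of_le_of_ne (hnn i hij) (Ne.symm hi0)
  have hbetween : ∀ t, i < t → t < j → x t = 0 := fun t h1 h2 => by
    by_contra h3
    exact (himax t ⟨h2, h3⟩).not_gt h1
  set μ : ℝ := min (x i) (-x j) with hμ
  have hμpos : 0 < μ := lt_min hipos (by linarith)
  have hμi : μ ≤ x i := min_le_left _ _
  have hμj : μ ≤ -x j := min_le_right _ _
  set y : Fin n → ℝ := x - μ • root i j with hy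
  have yi : y i = x i - μ := by simp [hy, root, hij.ne]
  have yj : y j = x j + μ := by simp [hy, root, hij.ne']
  have yt : ∀ t, t ≠ i → t ≠ j → y t = x t := fun t h1 h2 => by simp [hy, root, h1, h2]
  have hzero : y i = 0 ∨ y j = 0 := by
    rcases min_choice (x i) (-x j) with h | h
    · left; rw [yi, hμ, h, sub_self]
    · right; rw [yj, hμ, h, add_neg_cancel]
  have hsub : ∀ t, y t ≠ 0 → x t ≠ 0 := by
    intro t ht
    by_cases h1 : t = i
    · rwa [h1]
    by_cases h2 : t = j
    · rw [h2]; exact hj.ne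
    rwa [← yt t h1 h2]
  have hlt : (Finset.univ.filter fun k => y k ≠ 0).card < m := by
    rw [← hm]
    refine Finset.card_lt_card (Finset.ssubset_iff_subset_ne.2 ⟨?_, ?_⟩)
    · intro t ht
      simp only [Finset.mem_filter, Finset.mem_univ, true_and] at ht ⊢
      exact hsub t ht
    · intro heq
      have heq' : ∀ t, x t ≠ 0 → y t ≠ 0 := fun t ht => by
        have ht' : t ∈ Finset.univ.filter fun k => x k ≠ 0 := by simpa
        rw [← heq] at ht'
        exact (Finset.mem_filter.1 ht').2
      rcases hzero with h | h
      · exact heq' i hi0 h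
      · exact heq' j hj.ne h
  have hy0 : ∑ k, y k = 0 := by
    simp_rw [hy, Pi.sub_apply, Pi.smul_apply, Finset.sum_sub_distrib, ← Finset.smul_sum, sum_root,
      h0, smul_zero, sub_zero]
  have hysum : ∀ k, 0 ≤ ∑ t ∈ Finset.Iic k, y t := by
    intro k
    have e : ∑ t ∈ Finset.Iic k, y t =
        ∑ t ∈ Finset.Iic k, x t - μ * ((if i ≤ k then 1 else 0) - if j ≤ k then 1 else 0) := by
      simp [hy, root, Finset.sum_sub_distrib, ← Finset.mul_sum, Finset.sum_pi_single']
    rw [e]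
    have hxk := hx k
    by_cases h1 : j ≤ k
    · simpa [h1, hij.le.trans h1] using hxk
    · by_cases h2 : i ≤ k
      · have h3 : x i ≤ ∑ t ∈ Finset.Iic k, x t :=
          Finset.single_le_sum (f := x)
            (fun t ht => hnn t ((Finset.mem_Iic.1 ht).trans_lt (not_le.1 h1)))
            (Finset.mem_Iic.2 h2)
        simp only [h1, h2, if_true, if_false]
        linarith
      · simpa [h1, h2] using hxk
  obtain ⟨F, a, hF, ha, hs, hsgn, hcomb⟩ := ih _ hlt y hy0 hysum rfl
  have hsgn' : ∀ b ∈ F, 0 < x b.src ∧ x b.tgt < 0 := by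
    intro b hb
    obtain ⟨h1, h2⟩ := hsgn b hb
    constructor
    · by_cases h3 : b.src = i
      · rwa [h3]
      by_cases h4 : b.src = j
      · rw [h4, yj] at h1
        linarith
      rwa [← yt _ h3 h4]
    · by_cases h3 : b.tgt = i
      · rw [h3, yi] at h2
        linarith
      by_cases h4 : b.tgt = j
      · rwa [h4]
      rwa [← yt _ h3 h4]
  refine ⟨insert (edgeBox hij) F, a + Pi.single (edgeBox hij) μ, ?_, ?_, ?_, ?_, ?_⟩
  · intro b hb b' hb' e1 e2 e3
    rw [Finset.mem_insert] at hb hb'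
    rcases hb with rfl | hb <;> rcases hb' with rfl | hb'
    · exact lt_irrefl _ e1
    · rw [edgeBox_src] at e1
      rw [edgeBox_tgt] at e2
      have h1 := (hsgn' b' hb').1
      rcases e2.eq_or_lt with h2 | h2
      · rw [h2] at h1
        exact h1.not_gt hj
      · exact h1.ne' (hbetween _ e1 h2)
    · rw [edgeBox_tgt] at e3
      exact (hsgn' b hb).2.not_ge (hnn _ e3)
    · exact hF b hb b' hb' e1 e2 e3
  · intro b
    refine add_nonneg (ha b) ?_
    rw [Pi.single_apply]
    split_ifs
    · exact hμpos.le
    · exact le_rfl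
  · intro b hb
    rw [Finset.mem_insert, not_or] at hb
    simp [hs b hb.2, hb.1]
  · intro b hb
    rw [Finset.mem_insert] at hb
    rcases hb with rfl | hb
    · simpa using ⟨hipos, hj⟩
    · exact hsgn' b hb
  · rw [rootComb_add, hcomb, rootComb_single, edgeBox_src, edgeBox_tgt, hy, sub_add_cancel]

/-! ### Vertex figures of root polytopes at the origin -/

theorem mem_extremePoints_convexHull_of_forall_lt {E : Type*} [AddCommGroup E] [Module ℝ E]
    {S : Set E} {v : E} (g : Module.Dual ℝ E) (hv : v ∈ S) (h : ∀ u ∈ S, u ≠ v → g u < g v) :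
    v ∈ (convexHull ℝ S).extremePoints ℝ := by
  have hQ : Convex ℝ {x : E | x = v ∨ g x < g v} := by
    have hle : ∀ x : E, x = v ∨ g x < g v → g x ≤ g v := by
      rintro x (rfl | hx)
      · exact le_rfl
      · exact hx.le
    rw [convex_iff_forall_pos]
    intro x hx y hy s t hs ht hst
    by_cases hxy : x = v ∧ y = v
    · left
      rw [hxy.1, hxy.2, ← add_smul, hst, one_smul]
    right
    have h1 := hle x hx
    have h2 := hle y hy
    rw [map_add, map_smul, map_smul, smul_eq_mul, smul_eq_mul]
    have h3 : g x < g v ∨ g y < g v := by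
      rcases hx with rfl | hx
      · rcases hy with rfl | hy
        · exact absurd ⟨rfl, rfl⟩ hxy
        · exact Or.inr hy
      · exact Or.inl hx
    have h4 : g v = s * g v + t * g v := by rw [← add_mul, hst, one_mul]
    rw [h4]
    rcases h3 with h3 | h3
    · exact add_lt_add_of_lt_of_le (mul_lt_mul_of_pos_left h3 hs)
        (mul_le_mul_of_nonneg_left h2 ht.le)
    · exact add_lt_add_of_le_of_lt (mul_le_mul_of_nonneg_left h1 hs.le)
        (mul_lt_mul_of_pos_left h3 ht)
  have hsub : convexHull ℝ S ⊆ {x : E | x = v ∨ g x < g v} := by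
    refine convexHull_min (fun u hu => ?_) hQ
    by_cases huv : u = v
    · exact Or.inl huv
    · exact Or.inr (h u hu huv)
  have hle : ∀ x ∈ convexHull ℝ S, g x ≤ g v := by
    intro x hx
    rcases hsub hx with rfl | hx
    · exact le_rfl
    · exact hx.le
  rw [mem_extremePoints_iff_left]
  refine ⟨subset_convexHull ℝ S hv, fun x hx y hy hxy => ?_⟩
  obtain ⟨s, t, hs, ht, hst, hv'⟩ := hxy
  rcases hsub hx with h1 | h1
  · exact h1
  · exfalso
    have h2 := hle y hy
    have h3 := congrArg g hv'
    rw [map_add, map_smul, map_smul, smul_eq_mul, smul_eq_mul] at h3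
    have h4 : g v = s * g v + t * g v := by rw [← add_mul, hst, one_mul]
    have h5 := mul_lt_mul_of_pos_left h1 hs
    have h6 := mul_le_mul_of_nonneg_left h2 ht.le
    linarith

theorem root_mem_rootCone_pathGraph {n : ℕ} {i j : Fin n} (h : i ≤ j) :
    root i j ∈ rootCone (SimpleGraph.pathGraph n) := by
  obtain ⟨j, hj⟩ := j
  induction j with
  | zero =>
    have : i = ⟨0, hj⟩ := le_antisymm h (Fin.le_def.2 (Nat.zero_le _))
    rw [this, root, sub_self]
    exact Submodule.zero_mem _
  | succ j ih =>
    rcases h.eq_or_lt with h | h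
    · rw [h, root, sub_self]
      exact Submodule.zero_mem _
    · have e : root i ⟨j + 1, hj⟩ = root i ⟨j, by omega⟩ + root ⟨j, by omega⟩ ⟨j + 1, hj⟩ := by
        simp [root]
      rw [e]
      refine Submodule.add_mem _ (ih (by omega) ?_) (Submodule.subset_span ⟨_, _, ?_, ?_, rfl⟩)
      · rw [Fin.lt_def] at h
        rw [Fin.le_def]
        exact Nat.lt_succ_iff.1 h
      · exact Fin.lt_def.2 (Nat.lt_succ_self j)
      · exact SimpleGraph.pathGraph_adj.2 (Or.inl rfl)

theorem rootPolytope_pathGraph (n : ℕ) :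
    rootPolytope (SimpleGraph.pathGraph n) = convexHull ℝ (insert 0 (positiveRoots n)) := by
  rw [rootPolytope, Set.inter_eq_left.2]
  rintro _ ⟨i, j, hij, rfl⟩
  exact root_mem_rootCone_pathGraph hij.le

theorem rootPolytope_subset_pathGraph {n : ℕ} (G : SimpleGraph (Fin n)) :
    rootPolytope G ⊆ rootPolytope (SimpleGraph.pathGraph n) := by
  rw [rootPolytope_pathGraph]
  exact convexHull_mono (Set.insert_subset_insert Set.inter_subset_left)

theorem rootPolytope_subset_rootCone {n : ℕ} (G : SimpleGraph (Fin n)) :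
    rootPolytope G ⊆ rootCone G := by
  refine convexHull_min ?_ (PointedCone.convex _)
  rw [Set.insert_subset_iff]
  exact ⟨Submodule.zero_mem _, Set.inter_subset_right⟩

theorem mem_rootCone_boxGraph {n : ℕ} {F : Finset (Box n)} {x : Fin n → ℝ} :
    x ∈ rootCone (boxGraph F) ↔
      ∃ a : Box n → ℝ, (∀ b, 0 ≤ a b) ∧ (∀ b ∉ F, a b = 0) ∧ rootComb a = x := by
  classical
  constructor
  · intro hx
    induction hx using Submodule.span_induction with
    | mem x hx =>
      obtain ⟨i, j, hij, hadj, rfl⟩ := hx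
      rw [boxGraph_adj_of_lt hij] at hadj
      refine ⟨Pi.single (edgeBox hij) 1, fun b => ?_, fun b hb => ?_, ?_⟩
      · rw [Pi.single_apply]
        split_ifs <;> norm_num
      · rw [Pi.single_apply, if_neg]
        rintro rfl
        exact hb hadj
      · rw [rootComb_single, edgeBox_src, edgeBox_tgt, one_smul]
    | zero => exact ⟨0, fun b => le_rfl, fun b _ => rfl, by simp [rootComb]⟩
    | add x y _ _ hx hy =>
      obtain ⟨a, ha, hs, rfl⟩ := hx
      obtain ⟨a', ha', hs', rfl⟩ := hy
      exact ⟨a + a', fun b => add_nonneg (ha b) (ha' b),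
        fun b hb => by simp [hs b hb, hs' b hb], rootComb_add a a'⟩
    | smul t x _ hx =>
      obtain ⟨a, ha, hs, rfl⟩ := hx
      exact ⟨(t : ℝ) • a, fun b => mul_nonneg t.2 (ha b),
        fun b hb => by simp [hs b hb], rootComb_smul _ a⟩
  · rintro ⟨a, ha, hs, rfl⟩
    refine Submodule.sum_mem _ fun b _ => ?_
    by_cases hb : b ∈ F
    · exact Submodule.smul_mem _ (⟨a b, ha b⟩ : {t : ℝ // 0 ≤ t}) (Submodule.subset_span
        ⟨_, _, b.src_lt_tgt, (boxGraph_adj_src_tgt b).2 hb, rfl⟩)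
    · rw [hs b hb, zero_smul]
      exact Submodule.zero_mem _

/-- The point in which the ray spanned by the root of a box meets the hyperplane `f = β`. -/
noncomputable def slicePoint {n : ℕ} (f : Module.Dual ℝ (Fin n → ℝ)) (β : ℝ) (b : Box n) :
    Fin n → ℝ :=
  (β / f (root b.src b.tgt)) • root b.src b.tgt

section Slice

variable {n : ℕ} {f : Module.Dual ℝ (Fin n → ℝ)} {β : ℝ}

theorem slicePoint_eq_rootComb (b : Box n) :
    slicePoint f β b = rootComb (Pi.single b (β / f (root b.src b.tgt))) := by
  rw [rootComb_single, slicePoint]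

theorem apply_slicePoint (hβ : 0 < β) (hf : ∀ b : Box n, β < f (root b.src b.tgt)) (b : Box n) :
    f (slicePoint f β b) = β := by
  rw [slicePoint, map_smul, smul_eq_mul, div_mul_cancel₀]
  exact (hβ.trans (hf b)).ne'

theorem mem_convexHull_slicePoint (hβ : 0 < β) (hf : ∀ b : Box n, β < f (root b.src b.tgt))
    {F : Finset (Box n)} {x : Fin n → ℝ} :
    x ∈ convexHull ℝ (slicePoint f β '' (F : Set (Box n))) ↔
      ∃ a : Box n → ℝ, (∀ b, 0 ≤ a b) ∧ (∀ b ∉ F, a b = 0) ∧ rootComb a = x ∧ f x = β := by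
  classical
  have hpos : ∀ b : Box n, 0 < f (root b.src b.tgt) := fun b => hβ.trans (hf b)
  constructor
  · intro hx
    have hconv : Convex ℝ {x : Fin n → ℝ | ∃ a : Box n → ℝ,
        (∀ b, 0 ≤ a b) ∧ (∀ b ∉ F, a b = 0) ∧ rootComb a = x ∧ f x = β} := by
      rintro x ⟨a, ha, hs, rfl, hx⟩ y ⟨a', ha', hs', rfl, hy⟩ s t hs0 ht0 hst
      refine ⟨s • a + t • a', fun b => ?_, fun b hb => ?_, ?_, ?_⟩
      · exact add_nonneg (mul_nonneg hs0 (ha b)) (mul_nonneg ht0 (ha' b))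
      · simp [hs b hb, hs' b hb]
      · rw [rootComb_add, rootComb_smul, rootComb_smul]
      · rw [map_add, map_smul, map_smul, hx, hy, ← add_smul, hst, one_smul]
    refine convexHull_min ?_ hconv hx
    rintro _ ⟨b, hb, rfl⟩
    refine ⟨_, fun b' => ?_, fun b' hb' => ?_, (slicePoint_eq_rootComb b).symm,
      apply_slicePoint hβ hf b⟩
    · rw [Pi.single_apply]
      split_ifs
      · exact (div_pos hβ (hpos b)).le
      · exact le_rfl
    · rw [Pi.single_apply, if_neg]
      rintro rfl
      exact hb' hb
  · rintro ⟨a, ha, hs, rfl, hx⟩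
    have hsum : ∑ b ∈ F, a b * f (root b.src b.tgt) = β := by
      rw [← hx, map_rootComb]
      exact Finset.sum_subset (Finset.subset_univ F) fun b _ hb => by rw [hs b hb, zero_mul]
    have hrep : rootComb a =
        ∑ b ∈ F, (a b * f (root b.src b.tgt) / β) • slicePoint f β b := by
      rw [rootComb, ← Finset.sum_subset (Finset.subset_univ F)]
      · refine Finset.sum_congr rfl fun b _ => ?_
        rw [slicePoint, smul_smul]
        congr 1
        have := (hpos b).ne'
        field_simp
      · intro b _ hb
        rw [hs b hb, zero_smul]
    rw [hrep]
    refine (convex_convexHull ℝ _).sum_mem (fun b _ => ?_) ?_ fun b hb => ?_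
    · exact div_nonneg (mul_nonneg (ha b) (hpos b).le) hβ.le
    · rw [← Finset.sum_div, hsum, div_self hβ.ne']
    · exact subset_convexHull ℝ _ ⟨b, hb, rfl⟩

/-- The slice of a root polytope is spanned by the points on the rays of the edges of the graph: the
further roots in the cone add nothing. -/
theorem rootPolytope_inter_eq (hβ : 0 < β) (hf : ∀ b : Box n, β < f (root b.src b.tgt))
    (F : Finset (Box n)) :
    rootPolytope (boxGraph F) ∩ {x | f x = β} =
      convexHull ℝ (slicePoint f β '' (F : Set (Box n))) := by
  ext x
  constructor
  · rintro ⟨hx, hfx⟩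
    obtain ⟨a, ha, hs, h⟩ := mem_rootCone_boxGraph.1 (rootPolytope_subset_rootCone _ hx)
    exact (mem_convexHull_slicePoint hβ hf).2 ⟨a, ha, hs, h, hfx⟩
  · intro hx
    obtain ⟨-, -, -, -, hfx⟩ := (mem_convexHull_slicePoint hβ hf).1 hx
    refine ⟨convexHull_min ?_ (convex_convexHull ℝ _) hx, hfx⟩
    rintro _ ⟨b, hb, rfl⟩
    have h0 : (0 : Fin n → ℝ) ∈ rootPolytope (boxGraph F) :=
      subset_convexHull ℝ _ (Set.mem_insert _ _)
    have h1 : root b.src b.tgt ∈ rootPolytope (boxGraph F) := by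
      refine subset_convexHull ℝ _ (Set.mem_insert_of_mem _ ⟨⟨_, _, b.src_lt_tgt, rfl⟩, ?_⟩)
      exact Submodule.subset_span ⟨_, _, b.src_lt_tgt, (boxGraph_adj_src_tgt b).2 hb, rfl⟩
    have hpos := hβ.trans (hf b)
    have h2 : β / f (root b.src b.tgt) ≤ 1 := (div_le_one hpos).2 (hf b).le
    have h3 := (convex_convexHull ℝ _ : Convex ℝ (rootPolytope (boxGraph F))) h0 h1
      (sub_nonneg.2 h2) (div_pos hβ hpos).le (sub_add_cancel _ _)
    rwa [smul_zero, zero_add] at h3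

theorem single_div_nonneg (hβ : 0 < β) (hf : ∀ b : Box n, β < f (root b.src b.tgt))
    (b b' : Box n) : 0 ≤ (Pi.single b (β / f (root b.src b.tgt)) : Box n → ℝ) b' := by
  rw [Pi.single_apply]
  split_ifs
  · exact (div_pos hβ (hβ.trans (hf b))).le
  · exact le_rfl

theorem slicePoint_injective (hβ : 0 < β) (hf : ∀ b : Box n, β < f (root b.src b.tgt)) :
    Function.Injective (slicePoint f β) := by
  intro b b' h
  rw [slicePoint_eq_rootComb, slicePoint_eq_rootComb] at h
  have h1 := rootComb_unique (isNCAlt_singleton b) (isNCAlt_singleton b')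
    (single_div_nonneg hβ hf b) (single_div_nonneg hβ hf b')
    (fun c hc => by simp_all) (fun c hc => by simp_all) h
  have h2 := congrFun h1 b
  by_contra hne
  rw [Pi.single_eq_same, Pi.single_eq_of_ne hne] at h2
  exact (div_pos hβ (hβ.trans (hf b))).ne' h2

theorem extremePoints_convexHull_slicePoint (hβ : 0 < β)
    (hf : ∀ b : Box n, β < f (root b.src b.tgt)) {F : Finset (Box n)} (hF : IsNCAlt F) :
    (convexHull ℝ (slicePoint f β '' (F : Set (Box n)))).extremePoints ℝ =
      slicePoint f β '' (F : Set (Box n)) := by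
  refine extremePoints_convexHull_subset.antisymm ?_
  rintro _ ⟨b, hb, rfl⟩
  rw [mem_extremePoints_iff_left]
  refine ⟨subset_convexHull ℝ _ ⟨b, hb, rfl⟩, ?_⟩
  rintro x hx y hy ⟨s, t, hs, ht, hst, h⟩
  obtain ⟨a, ha, has, rfl, hfx⟩ := (mem_convexHull_slicePoint hβ hf).1 hx
  obtain ⟨a', ha', has', rfl, -⟩ := (mem_convexHull_slicePoint hβ hf).1 hy
  rw [slicePoint_eq_rootComb, ← rootComb_smul, ← rootComb_smul, ← rootComb_add] at h
  have h1 := rootComb_unique hF hF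
    (fun c => add_nonneg (mul_nonneg hs.le (ha c)) (mul_nonneg ht.le (ha' c)))
    (single_div_nonneg hβ hf b) (fun c hc => by simp [has c hc, has' c hc])
    (fun c hc => Pi.single_eq_of_ne (fun hcb : c = b => hc (by rwa [hcb])) _) h
  have h2 : a = Pi.single b (a b) := by
    funext c
    by_cases hcb : c = b
    · rw [hcb, Pi.single_eq_same]
    · rw [Pi.single_eq_of_ne hcb]
      have h3 := congrFun h1 c
      rw [Pi.single_eq_of_ne hcb] at h3
      have h4 := mul_nonneg hs.le (ha c)
      have h5 := mul_nonneg ht.le (ha' c)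
      exact (mul_eq_zero.1 (show s * a c = 0 by linarith)).resolve_left hs.ne'
  rw [h2, rootComb_single, map_smul, smul_eq_mul] at hfx
  rw [h2, rootComb_single, slicePoint, ← hfx, mul_div_cancel_right₀]
  exact (hβ.trans (hf b)).ne'

theorem affineIndependent_slicePoint (hβ : 0 < β)
    (hf : ∀ b : Box n, β < f (root b.src b.tgt)) {F : Finset (Box n)} (hF : IsNCAlt F) :
    AffineIndependent ℝ
      ((↑) : (slicePoint f β '' (F : Set (Box n)) : Set (Fin n → ℝ)) → Fin n → ℝ) := by
  have h := (hF.linearIndependent (t := fun b => β / f (root b.src b.tgt))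
    (fun b => (div_pos hβ (hβ.trans (hf b))).ne')).affineIndependent.range
  have e : Set.range (fun b : F => (β / f (root b.1.src b.1.tgt)) • root b.1.src b.1.tgt) =
      slicePoint f β '' (F : Set (Box n)) := by
    rw [Set.image_eq_range]
    rfl
  rwa [e] at h

/-- By uniqueness of coefficients, points common to several simplices lie in the simplex on the
common vertices. -/
theorem mem_convexHull_slicePoint_of_forall (hβ : 0 < β)
    (hf : ∀ b : Box n, β < f (root b.src b.tgt)) {S : Set (Finset (Box n))} (hne : S.Nonempty)
    (hS : ∀ F ∈ S, IsNCAlt F) {x : Fin n → ℝ}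
    (hx : ∀ F ∈ S, x ∈ convexHull ℝ (slicePoint f β '' (F : Set (Box n)))) {D : Finset (Box n)}
    (hD : ∀ b, (∀ F ∈ S, b ∈ F) → b ∈ D) :
    x ∈ convexHull ℝ (slicePoint f β '' (D : Set (Box n))) := by
  obtain ⟨F₀, hF₀⟩ := hne
  obtain ⟨a, ha, hs, h, hfx⟩ := (mem_convexHull_slicePoint hβ hf).1 (hx F₀ hF₀)
  refine (mem_convexHull_slicePoint hβ hf).2 ⟨a, ha, fun b hb => ?_, h, hfx⟩
  have hb' : ¬ ∀ F ∈ S, b ∈ F := fun h' => hb (hD b h')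
  push Not at hb'
  obtain ⟨F, hF, hbF⟩ := hb'
  obtain ⟨a', ha', hs', h', -⟩ := (mem_convexHull_slicePoint hβ hf).1 (hx F hF)
  rw [rootComb_unique (hS F₀ hF₀) (hS F hF) ha ha' hs hs' (h.trans h'.symm)]
  exact hs' b hbF

/-- The simplices with noncrossing alternating vertex sets cover the slice. -/
theorem exists_isNCAlt_mem_convexHull (hβ : 0 < β)
    (hf : ∀ b : Box n, β < f (root b.src b.tgt)) {x : Fin n → ℝ}
    (hx : x ∈ rootPolytope (SimpleGraph.pathGraph n)) (hfx : f x = β) :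
    ∃ F : Finset (Box n), IsNCAlt F ∧ F.Nonempty ∧
      x ∈ convexHull ℝ (slicePoint f β '' (F : Set (Box n))) := by
  have h1 : x ∈ rootCone (SimpleGraph.pathGraph n) := rootPolytope_subset_rootCone _ hx
  rw [← boxGraph_graphBoxes (SimpleGraph.pathGraph n), mem_rootCone_boxGraph] at h1
  obtain ⟨a, ha, -, rfl⟩ := h1
  obtain ⟨F, a', hF, ha', hs, -, h⟩ :=
    exists_rootComb_eq _ (rootComb_mem_hyperplane a) (sum_Iic_rootComb_nonneg ha)
  refine ⟨F, hF, ?_, (mem_convexHull_slicePoint hβ hf).2 ⟨a', ha', hs, h, hfx⟩⟩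
  by_contra hemp
  rw [Finset.not_nonempty_iff_eq_empty] at hemp
  have h0 : a' = 0 := by
    funext b
    exact hs b (by simp [hemp])
  rw [← h, h0] at hfx
  simp only [rootComb, Pi.zero_apply, zero_smul, Finset.sum_const_zero, map_zero] at hfx
  exact hβ.ne hfx

end Slice

theorem root_mem_extremePoints {n : ℕ} {i j : Fin n} (hij : i < j) :
    root i j ∈ (rootPolytope (SimpleGraph.pathGraph n)).extremePoints ℝ := by
  rw [rootPolytope_pathGraph]
  obtain ⟨g, hval⟩ : ∃ g : Module.Dual ℝ (Fin n → ℝ), ∀ u, g u = u i - u j :=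
    ⟨(LinearMap.proj i : (Fin n → ℝ) →ₗ[ℝ] ℝ) - (LinearMap.proj j : (Fin n → ℝ) →ₗ[ℝ] ℝ),
      fun u => rfl⟩
  refine mem_extremePoints_convexHull_of_forall_lt g (Set.mem_insert_of_mem _ ⟨i, j, hij, rfl⟩) ?_
  have hroot : root i j i - root i j j = 2 := by
    simp only [root, Pi.sub_apply, Pi.single_eq_same, Pi.single_eq_of_ne hij.ne,
      Pi.single_eq_of_ne hij.ne']
    norm_num
  rw [hval, hroot]
  rintro u (rfl | ⟨k, l, hkl, rfl⟩) hu
  · rw [hval]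
    norm_num
  · rw [hval]
    have hne : ¬ (i = k ∧ j = l) := by
      rintro ⟨rfl, rfl⟩
      exact hu rfl
    simp only [root, Pi.sub_apply, Pi.single_apply]
    split_ifs <;> first | (exfalso; omega) | norm_num

theorem zero_mem_extremePoints (n : ℕ) :
    (0 : Fin n → ℝ) ∈ (rootPolytope (SimpleGraph.pathGraph n)).extremePoints ℝ ∧
      ∃ f : Module.Dual ℝ (Fin n → ℝ), ∀ i j : Fin n, i < j → 1 ≤ f (root i j) := by
  have key : ∀ i j : Fin n, i < j →
      (∑ k : Fin n, (k.val : ℝ) • (LinearMap.proj k : (Fin n → ℝ) →ₗ[ℝ] ℝ)) (root i j) ≤ -1 := by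
    intro i j hij
    have h1 : (i.val : ℝ) + 1 ≤ j.val := by exact_mod_cast Fin.lt_def.1 hij
    simp only [LinearMap.sum_apply, LinearMap.smul_apply, LinearMap.proj_apply, root,
      Pi.sub_apply, smul_eq_mul, mul_sub, Finset.sum_sub_distrib, Pi.single_apply, mul_ite, mul_one,
      mul_zero, Finset.sum_ite_eq', Finset.mem_univ, if_true]
    linarith
  refine ⟨?_, -∑ k : Fin n, (k.val : ℝ) • (LinearMap.proj k : (Fin n → ℝ) →ₗ[ℝ] ℝ),
    fun i j hij => ?_⟩
  · rw [rootPolytope_pathGraph]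
    refine mem_extremePoints_convexHull_of_forall_lt
      (∑ k : Fin n, (k.val : ℝ) • (LinearMap.proj k : (Fin n → ℝ) →ₗ[ℝ] ℝ))
      (Set.mem_insert _ _) ?_
    rintro u (rfl | ⟨i, j, hij, rfl⟩) hu
    · exact absurd rfl hu
    · rw [map_zero]
      have := key i j hij
      linarith
  · have := key i j hij
    rw [LinearMap.neg_apply]
    linarith

theorem exists_isVertexFigure {n : ℕ} (hn : 2 ≤ n) :
    ∃ V, IsVertexFigure (rootPolytope (SimpleGraph.pathGraph n)) 0 V := by
  obtain ⟨h0, f, hf⟩ := zero_mem_extremePoints n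
  refine ⟨_, h0, f, 1 / 2, ?_, ?_, fun u hu hu0 => ?_, rfl⟩
  · rintro rfl
    have := hf ⟨0, by omega⟩ ⟨1, by omega⟩ (Fin.lt_def.2 Nat.one_pos)
    rw [LinearMap.zero_apply] at this
    linarith
  · rw [map_zero]
    norm_num
  · rw [rootPolytope_pathGraph] at hu
    rcases extremePoints_convexHull_subset hu with rfl | ⟨i, j, hij, rfl⟩
    · exact absurd rfl hu0
    · have := hf i j hij
      linarith

/-- Since all positive roots are vertices, the hyperplane of a vertex figure at `0` separates `0`
from all of them. -/
theorem IsVertexFigure.exists_slice {n : ℕ} {V : Set (Fin n → ℝ)}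
    (hV : IsVertexFigure (rootPolytope (SimpleGraph.pathGraph n)) 0 V) :
    ∃ (f : Module.Dual ℝ (Fin n → ℝ)) (β : ℝ), 0 < β ∧
      (∀ b : Box n, β < f (root b.src b.tgt)) ∧
      V = rootPolytope (SimpleGraph.pathGraph n) ∩ {x | f x = β} := by
  obtain ⟨-, f, β, -, h0, h1, h2⟩ := hV
  rw [map_zero] at h0
  refine ⟨f, β, h0, fun b => h1 _ (root_mem_extremePoints b.src_lt_tgt) fun h => ?_, h2⟩
  have h3 := congrFun h b.src
  simp [root, b.src_lt_tgt.ne] at h3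

/-! ### Pipes -/

section Pipes

variable {n : ℕ} {C : Finset (Box n)}

theorem HasCross.lt {r c : ℕ} (h : HasCross C r c) : r + c + 1 < n := by
  obtain ⟨b, -, rfl, rfl⟩ := h
  exact b.row_add_col_lt

theorem hasCross_row_col {b : Box n} : HasCross C b.row b.col ↔ b ∈ C := by
  constructor
  · rintro ⟨b', hb', h1, h2⟩
    rwa [← Box.ext_row_col h1 h2]
  · exact fun h => ⟨b, h, rfl, rfl⟩

theorem hasCross_edge {i j : Fin n} (h : i < j) :
    HasCross C (n - 1 - j.val) i.val ↔ edgeBox h ∈ C :=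
  hasCross_row_col (b := edgeBox h)

/-- Two pipes do not enter a tile through the same side. -/
theorem PipeEnters.injective {i j r c : ℕ} {s : Side} (h : PipeEnters C i r c s)
    (h' : PipeEnters C j r c s) : i = j := by
  induction h with
  | start =>
    cases h'
    rfl
  | crossRight _ hc ih =>
    cases h' with
    | crossRight h1 _ => exact ih h1
    | elbowRight _ h2 => exact absurd hc h2
  | elbowRight _ hc ih =>
    cases h' with
    | crossRight _ h2 => exact absurd h2 hc
    | elbowRight h1 _ => exact ih h1
  | crossUp _ hc ih =>
    cases h' with
    | crossUp h1 _ => exact ih h1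
    | elbowUp _ h2 => exact absurd hc h2
  | elbowUp _ hc ih =>
    cases h' with
    | crossUp _ h2 => exact absurd h2 hc
    | elbowUp h1 _ => exact ih h1

theorem PipeExits.injective {i j c : ℕ} (h : PipeExits C i c) (h' : PipeExits C j c) : i = j := by
  rcases h with ⟨h1, h2⟩ | ⟨h1, h2⟩ <;> rcases h' with ⟨h3, h4⟩ | ⟨h3, h4⟩
  · exact h1.injective h3
  · exact absurd h2 h4
  · exact absurd h4 h2
  · exact h1.injective h3

theorem PipeEnters.row_le {i r c : ℕ} {s : Side} (h : PipeEnters C i r c s) :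
    r ≤ i ∧ (s = Side.bottom → r < i) := by
  induction h with
  | start => exact ⟨le_rfl, fun h => by cases h⟩
  | crossRight _ _ ih => exact ⟨ih.1, fun h => by cases h⟩
  | elbowRight _ _ ih => exact ⟨ih.1, fun h => by cases h⟩
  | crossUp _ _ ih => exact ⟨by omega, fun _ => by omega⟩
  | elbowUp _ _ ih => exact ⟨by omega, fun _ => by omega⟩

theorem PipeEnters.row_lt {i r c : ℕ} (h : PipeEnters C i r c Side.bottom) : r < i :=
  h.row_le.2 rfl

theorem exists_pipeEnters_bottom {c : ℕ} (hleft : ∀ r, ∃ i, PipeEnters C i r c Side.left) (r : ℕ) :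
    ∃ i, PipeEnters C i r c Side.bottom := by
  have key : ∀ m r, n ≤ r + m → ∃ i, PipeEnters C i r c Side.bottom := by
    intro m
    induction m with
    | zero =>
      intro r hr
      obtain ⟨i, hi⟩ := hleft (r + 1)
      exact ⟨i, hi.elbowUp fun h => by have := h.lt; omega⟩
    | succ m ih =>
      intro r hr
      by_cases h : HasCross C (r + 1) c
      · obtain ⟨i, hi⟩ := ih (r + 1) (by omega)
        exact ⟨i, hi.crossUp h⟩
      · obtain ⟨i, hi⟩ := hleft (r + 1)
        exact ⟨i, hi.elbowUp h⟩
  exact key n r (by omega)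

theorem exists_pipeEnters_left (c r : ℕ) : ∃ i, PipeEnters C i r c Side.left := by
  induction c generalizing r with
  | zero => exact ⟨r, PipeEnters.start⟩
  | succ c ih =>
    by_cases h : HasCross C r c
    · obtain ⟨i, hi⟩ := ih r
      exact ⟨i, hi.crossRight h⟩
    · obtain ⟨i, hi⟩ := exists_pipeEnters_bottom ih r
      exact ⟨i, hi.elbowRight h⟩

theorem PipeEnters.run_right {i r c : ℕ} (h : PipeEnters C i r c Side.left) {c' : ℕ} (hc : c ≤ c')
    (hrun : ∀ t, c ≤ t → t < c' → HasCross C r t) : PipeEnters C i r c' Side.left := by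
  induction c', hc using Nat.le_induction with
  | base => exact h
  | succ c' hc ih =>
    exact (ih fun t h1 h2 => hrun t h1 (by omega)).crossRight (hrun c' hc (Nat.lt_succ_self _))

theorem PipeEnters.run_up {i r c : ℕ} (h : PipeEnters C i r c Side.bottom) {r' : ℕ} (hr : r' ≤ r)
    (hrun : ∀ t, r' < t → t ≤ r → HasCross C t c) : PipeEnters C i r' c Side.bottom := by
  induction r, hr using Nat.le_induction with
  | base => exact h
  | succ r hr ih =>
    exact ih (h.crossUp (hrun (r + 1) (by omega) le_rfl)) fun t h1 h2 => hrun t h1 (by omega)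

/-- A pipe that gets beyond column `j` passes from column `j` to column `j + 1` in a row not below
its start. -/
theorem PipeEnters.exists_left {i r c j : ℕ} {s : Side} (h : PipeEnters C i r c s) (hj : j < c) :
    ∃ r', r' ≤ i ∧ PipeEnters C i r' (j + 1) Side.left := by
  induction h with
  | start => exact absurd hj (Nat.not_lt_zero _)
  | @crossRight r c h hc ih =>
    rcases (Nat.lt_succ_iff.1 hj).eq_or_lt with rfl | h'
    · exact ⟨r, h.row_le.1, h.crossRight hc⟩
    · exact ih h'
  | @elbowRight r c h hc ih =>
    rcases (Nat.lt_succ_iff.1 hj).eq_or_lt with rfl | h'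
    · exact ⟨r, h.row_le.1, h.elbowRight hc⟩
    · exact ih h'
  | crossUp _ _ ih => exact ih hj
  | elbowUp _ _ ih => exact ih hj

/-- To the right of an elbow, every tile of its row is entered from the left by a pipe that starts
below that row. -/
theorem exists_pipeEnters_right_of_elbow {r c : ℕ} (h : ¬ HasCross C r c) {c' : ℕ} (hc : c < c') :
    ∃ i, r < i ∧ PipeEnters C i r c' Side.left := by
  have turn : ∀ t, ¬ HasCross C r t → ∃ i, r < i ∧ PipeEnters C i r (t + 1) Side.left := by
    intro t ht
    obtain ⟨i, hi⟩ := exists_pipeEnters_bottom (fun r => exists_pipeEnters_left (C := C) t r) r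
    exact ⟨i, hi.row_lt, hi.elbowRight ht⟩
  induction c', hc using Nat.le_induction with
  | base => exact turn c h
  | succ c' hc ih =>
    by_cases h' : HasCross C r c'
    · obtain ⟨i, hi, hi'⟩ := ih
      exact ⟨i, hi, hi'.crossRight h'⟩
    · exact turn c' h'

theorem PipeEnters.exists_left_of_elbow {i r c r' : ℕ} (h : PipeEnters C i r c Side.bottom)
    (hr : r' ≤ r) (helbow : ¬ HasCross C r' c) :
    ∃ t, t ≤ r ∧ PipeEnters C i t (c + 1) Side.left := by
  induction r, hr using Nat.le_induction with
  | base => exact ⟨_, le_rfl, h.elbowRight helbow⟩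
  | succ r hr ih =>
    by_cases h' : HasCross C (r + 1) c
    · obtain ⟨t, ht, ht'⟩ := ih (h.crossUp h')
      exact ⟨t, by omega, ht'⟩
    · exact ⟨_, le_rfl, h.elbowRight h'⟩

theorem permOneRev_zero {i : Fin n} (h : i.val = 0) : permOneRev n i = i :=
  dif_pos h

theorem permOneRev_val {i : Fin n} (h : i.val ≠ 0) : (permOneRev n i).val = n - i.val :=
  congrArg Fin.val (dif_neg h)

/-- If the pipes intertwine according to `1 n n-1 ⋯ 2`, the elbows are noncrossing alternating.
Consider the rectangle spanned by the north-west corner of the table and the corner `(ρ, j)`, in the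
table or on its diagonal. The pipes `1, …, ρ` leave it through its right side, which has `ρ + 1`
places, so at most one pipe from below does so. Two elbows in the last row and in the last column,
other than the corner, would yield two such pipes. -/
theorem isNCAlt_compl_of_pipeExits (hC : ∀ i : Fin n, PipeExits C i (permOneRev n i)) :
    IsNCAlt Cᶜ := by
  intro b hb b' hb' h1 h2 h3
  have hb1 := b.row_add_col_lt
  have hb1' := b'.row_add_col_lt
  rw [Fin.lt_def, Box.src_val, Box.src_val] at h1
  rw [Fin.le_def, Box.src_val, Box.tgt_val] at h2
  rw [Fin.lt_def, Box.tgt_val, Box.tgt_val] at h3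
  rw [Finset.mem_compl, ← hasCross_row_col] at hb hb'
  obtain ⟨ρ, hρ⟩ : ∃ ρ, b.row = ρ + 1 := ⟨b.row - 1, by omega⟩
  rw [hρ] at hb h2 h3 hb1
  generalize b'.col = j at *
  obtain ⟨p, q, t, hp, hq, ht, hpe, hqe⟩ : ∃ p q t, ρ + 1 < p ∧ ρ + 1 < q ∧ t ≤ ρ ∧
      PipeEnters C p (ρ + 1) (j + 1) Side.left ∧ PipeEnters C q t (j + 1) Side.left := by
    obtain ⟨i, hi⟩ :=
      exists_pipeEnters_bottom (fun r => exists_pipeEnters_left (C := C) j r) (ρ + 1)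
    by_cases hcorner : HasCross C (ρ + 1) j
    · obtain ⟨p, hp, hpe⟩ := exists_pipeEnters_right_of_elbow hb (c' := j + 1) (by omega)
      obtain ⟨t, ht, hte⟩ := (hi.crossUp hcorner).exists_left_of_elbow (by omega) hb'
      exact ⟨p, i, t, hp, hi.row_lt, ht, hpe, hte⟩
    · obtain ⟨q, hq, hqe⟩ := exists_pipeEnters_right_of_elbow hb h1
      obtain ⟨t, ht, hte⟩ := (hqe.elbowUp hcorner).exists_left_of_elbow (by omega) hb'
      exact ⟨i, q, t, hi.row_lt, hq, ht, hi.elbowRight hcorner, hte⟩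
  have hpass : ∀ k ∈ Finset.Icc 1 (ρ + 1), ∃ r', r' ≤ k ∧ PipeEnters C k r' (j + 1) Side.left := by
    intro k hk
    rw [Finset.mem_Icc] at hk
    have hexit := hC ⟨k, by omega⟩
    rw [permOneRev_val (by simp only; omega)] at hexit
    rcases hexit with ⟨h4, -⟩ | ⟨h4, -⟩
    · exact h4.exists_left (by simp only; omega)
    · exact h4.exists_left (by simp only; omega)
  choose! g hg hg' using hpass
  have hcard : (Finset.Icc 1 (ρ + 1)).card ≤ ((Finset.range (ρ + 1)).erase t).card := by
    refine Finset.card_le_card_of_injOn g ?_ ?_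
    · intro k hk
      have hk' := Finset.mem_Icc.1 (Finset.mem_coe.1 hk)
      have e1 := hg k hk
      have e2 := hg' k hk
      rw [Finset.mem_coe, Finset.mem_erase, Finset.mem_range]
      have e3 : g k ≠ t := fun h => by
        rw [h] at e2
        have := e2.injective hqe
        omega
      have e4 : g k ≠ ρ + 1 := fun h => by
        rw [h] at e2
        have := e2.injective hpe
        omega
      exact ⟨e3, by omega⟩
    · intro k hk k' hk' h
      have e1 := hg' k hk
      rw [h] at e1
      exact e1.injective (hg' k' hk')
  rw [Nat.card_Icc, Finset.card_erase_of_mem (Finset.mem_range.2 (by omega)),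
    Finset.card_range] at hcard
  omega

theorem hasCross_compl_edge {F : Finset (Box n)} {i j : Fin n} (h : i < j) {r : ℕ}
    (hr : r + j.val + 1 = n) : HasCross Fᶜ r i ↔ edgeBox h ∉ F := by
  rw [← Finset.mem_compl, ← hasCross_edge h]
  have : r = n - 1 - j.val := by omega
  rw [this]

/-- In the pipe dream of a maximal noncrossing alternating set, the pipe that starts in the row of
the vertex `j` runs to the far left neighbour `c` of `j`, up to the far right neighbour `d` of
`j + 1`, to the right until `j + 1`, and then straight up. -/
theorem pipeExits_of_maximal {F : Finset (Box n)} (hF : Maximal IsNCAlt F) (i : Fin n) :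
    PipeExits Fᶜ i (permOneRev n i) := by
  classical
  have hi := i.2
  by_cases hi0 : i.val = 0
  · rw [permOneRev_zero hi0, hi0]
    refine Or.inr ⟨PipeEnters.start, fun hcross => ?_⟩
    have hn := hcross.lt
    have hlt : (⟨0, by omega⟩ : Fin n) < ⟨n - 1, by omega⟩ := Fin.lt_def.2 (by simp only; omega)
    rw [hasCross_compl_edge (i := ⟨0, by omega⟩) hlt (by simp only; omega)] at hcross
    refine hcross (hF.2 (y := insert (edgeBox hlt) F) ?_ (Finset.subset_insert _ _)
      (Finset.mem_insert_self _ _))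
    intro b hb b' hb' h1 h2 h3
    rw [Finset.mem_insert] at hb hb'
    rcases hb' with rfl | hb'
    · exact Nat.not_lt_zero _ (Fin.lt_def.1 h1)
    rcases hb with rfl | hb
    · rw [edgeBox_tgt, Fin.lt_def] at h3
      have := b'.tgt.2
      simp only at h3
      omega
    · exact hF.1 b hb b' hb' h1 h2 h3
  rw [permOneRev_val hi0]
  obtain ⟨m, hm⟩ : ∃ m, i.val = m + 1 := ⟨i.val - 1, by omega⟩
  obtain ⟨j, hj⟩ : ∃ j : Fin n, m + 1 + j.val + 1 = n :=
    ⟨⟨n - 1 - i.val, by omega⟩, by simp only; omega⟩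
  obtain ⟨k, hk⟩ : ∃ k : Fin n, j.val + 1 = k.val := ⟨⟨j.val + 1, by omega⟩, rfl⟩
  obtain ⟨c, hc⟩ := exists_isLeftEnd F j
  obtain ⟨d, hd⟩ := exists_isRightEnd F k
  have hcj := Fin.le_def.1 hc.le
  have hkd := Fin.le_def.1 hd.le
  have hcd : c < d := Fin.lt_def.2 (by omega)
  have hmem := edgeBox_mem_of_maximal hF hk hc hd hcd
  obtain ⟨s, hs⟩ : ∃ s, s + d.val + 1 = n := ⟨n - 1 - d.val, by have := d.2; omega⟩
  -- no edge `(c, y)` with `k ≤ y < d`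
  have hcol : ∀ y : Fin n, ∀ hy : c < y, k ≤ y → y < d → edgeBox hy ∉ F := by
    intro y hy hky hyd hyF
    exact hF.1 _ hyF _ (hd.mem (hky.trans_lt hyd))
      (by rw [edgeBox_src, edgeBox_src, Fin.lt_def]; omega) (by simpa) (by simpa)
  -- no edge `(x, d)` with `c < x ≤ j`
  have hrow : ∀ x : Fin n, ∀ hx : x < d, c < x → x ≤ j → edgeBox hx ∉ F := by
    intro x hx hcx hxj hxF
    exact hF.1 _ (hc.mem (hcx.trans_le hxj)) _ hxF (by simpa) (by simpa)
      (by rw [edgeBox_tgt, edgeBox_tgt, Fin.lt_def]; omega)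
  have p1 : PipeEnters Fᶜ i.val (m + 1) c.val Side.left := by
    rw [hm]
    refine PipeEnters.start.run_right (Nat.zero_le _) fun t _ ht => ?_
    have htj : (⟨t, by omega⟩ : Fin n) < j := Fin.lt_def.2 (by simp only; omega)
    refine (hasCross_compl_edge (i := ⟨t, by omega⟩) htj hj).2 fun hmem' => ?_
    have := Fin.le_def.1 (hc.min _ hmem' (by simp))
    simp only [edgeBox_src] at this
    omega
  have e1 : ¬ HasCross Fᶜ (m + 1) c.val := by
    intro hcross
    have hlt := hcross.lt
    have hcj' : c < j := Fin.lt_def.2 (by omega)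
    exact (hasCross_compl_edge hcj' hj).1 hcross (hc.mem hcj')
  have p2 : PipeEnters Fᶜ i.val s c.val Side.bottom := by
    refine (p1.elbowUp e1).run_up (by omega) fun t h1 h2 => ?_
    obtain ⟨y, hy⟩ : ∃ y : Fin n, t + y.val + 1 = n :=
      ⟨⟨n - 1 - t, by omega⟩, by simp only; omega⟩
    have hcy : c < y := Fin.lt_def.2 (by omega)
    exact (hasCross_compl_edge hcy hy).2
      (hcol y hcy (Fin.le_def.2 (by omega)) (Fin.lt_def.2 (by omega)))
  have e2 : ¬ HasCross Fᶜ s c.val := fun hcross => (hasCross_compl_edge hcd hs).1 hcross hmem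
  have p3 : PipeEnters Fᶜ i.val s k.val Side.left := by
    refine (p2.elbowRight e2).run_right (by omega) fun t h1 h2 => ?_
    have hx : (⟨t, by omega⟩ : Fin n) < d := Fin.lt_def.2 (by simp only; omega)
    exact (hasCross_compl_edge (i := ⟨t, by omega⟩) hx hs).2
      (hrow _ hx (Fin.lt_def.2 (by simp only; omega)) (Fin.le_def.2 (by simp only; omega)))
  have e3 : ¬ HasCross Fᶜ s k.val := by
    intro hcross
    have hlt := hcross.lt
    have hkd' : k < d := Fin.lt_def.2 (by omega)
    exact (hasCross_compl_edge hkd' hs).1 hcross (hd.mem hkd')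
  have hki : n - i.val = k.val := by omega
  rw [hki]
  have hup : ∀ t, t < s → HasCross Fᶜ t k.val := by
    intro t ht
    obtain ⟨y, hy⟩ : ∃ y : Fin n, t + y.val + 1 = n :=
      ⟨⟨n - 1 - t, by omega⟩, by simp only; omega⟩
    have hky : k < y := Fin.lt_def.2 (by omega)
    refine (hasCross_compl_edge hky hy).2 fun hmem' => ?_
    have := Fin.le_def.1 (hd.max _ hmem' (by simp))
    rw [edgeBox_tgt] at this
    omega
  rcases s with _ | s
  · exact Or.inr ⟨p3, e3⟩
  · exact Or.inl ⟨(p3.elbowUp e3).run_up (Nat.zero_le _) fun t _ h2 => hup t (by omega),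
      hup 0 (Nat.succ_pos s)⟩

end Pipes

/-! ### Pipes and subwords of the triangular word -/

section Words

variable {n : ℕ} {C : Finset (Box n)}

theorem simpleReflection_val (k : Fin (n - 1)) (x : Fin n) :
    (simpleReflection k x).val =
      if x.val = k.val then k.val + 1 else if x.val = k.val + 1 then k.val else x.val := by
  rw [simpleReflection, Equiv.swap_apply_def]
  simp only [Fin.ext_iff]
  split_ifs <;> rfl

open Classical in
/-- The factor that the position `(r, c)` contributes to the product of the subword at the crosses:
the simple reflection written there if there is a cross, and `1` otherwise. -/
noncomputable def crossPerm (C : Finset (Box n)) (r c : ℕ) : Equiv.Perm (Fin n) :=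
  if h : HasCross C r c then simpleReflection ⟨r + c, by have := h.lt; omega⟩ else 1

theorem crossPerm_val (h : HasCross C r c) (x : Fin n) :
    (crossPerm C r c x).val =
      if x.val = r + c then r + c + 1 else if x.val = r + c + 1 then r + c else x.val := by
  rw [crossPerm, dif_pos h, simpleReflection_val]

theorem crossPerm_of_not_hasCross (h : ¬ HasCross C r c) : crossPerm C r c = 1 := by
  rw [crossPerm, dif_neg h]

/-- `Sweep C r c σ`: the boxes south of row `r` and those in row `r` west of column `c` have been
read, backwards in reading order, and `σ` is the product of the letters at the crosses met so far.
Reading starts at the bottom of the table, and row `r` follows row `r + 1` when the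
latter is exhausted. -/
inductive Sweep (C : Finset (Box n)) : ℕ → ℕ → Equiv.Perm (Fin n) → Prop
  | start : Sweep C n 0 1
  | box {r c : ℕ} {σ : Equiv.Perm (Fin n)} : Sweep C r c σ → r + c + 1 < n →
      Sweep C r (c + 1) (crossPerm C r c * σ)
  | row {r c : ℕ} {σ : Equiv.Perm (Fin n)} : Sweep C (r + 1) c σ → n ≤ r + c + 2 →
      Sweep C r 0 σ

/-- The pipe `i` leaves the tile at `(r, c)` through its top. -/
def PipeLeavesTop (C : Finset (Box n)) (i r c : ℕ) : Prop :=
  (PipeEnters C i r c Side.bottom ∧ HasCross C r c) ∨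
    (PipeEnters C i r c Side.left ∧ ¬ HasCross C r c)

theorem PipeLeavesTop.pipeEnters {i r c : ℕ} (h : PipeLeavesTop C i (r + 1) c) :
    PipeEnters C i r c Side.bottom := by
  rcases h with ⟨h1, h2⟩ | ⟨h1, h2⟩
  · exact h1.crossUp h2
  · exact h1.elbowUp h2

/-- The pipe `i` is at place `k` of the boundary of the region south of row `r` and, in row `r`,
west of column `c`. The places are numbered along the boundary from the north-west corner of the
table: down its left side to row `r`, along the top of row `r`, down the left side of the tile
`(r, c)`, and along the bottom of the remaining part of row `r`. -/
inductive AtPlace (C : Finset (Box n)) (r c : ℕ) (i k : ℕ) : Prop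
  | waiting : k < r → i = k → AtPlace C r c i k
  | done : r ≤ k → k < r + c → PipeLeavesTop C i r (k - r) → AtPlace C r c i k
  | left : k = r + c → PipeEnters C i r c Side.left → AtPlace C r c i k
  | bottom : r + c < k → PipeEnters C i r (k - r - 1) Side.bottom → AtPlace C r c i k

theorem Sweep.atPlace {r c : ℕ} {σ : Equiv.Perm (Fin n)} (h : Sweep C r c σ) (i : Fin n) :
    AtPlace C r c i (σ i) := by
  induction h with
  | start => exact AtPlace.waiting i.2 rfl
  | @box r c σ h hrc ih =>
    rw [Equiv.Perm.mul_apply]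
    by_cases hc : HasCross C r c
    · rw [crossPerm_val hc]
      rcases ih with ⟨h1, h2⟩ | ⟨h1, h2, h3⟩ | ⟨h1, h2⟩ | ⟨h1, h2⟩
      · rw [if_neg (by omega), if_neg (by omega)]
        exact AtPlace.waiting h1 h2
      · rw [if_neg (by omega), if_neg (by omega)]
        exact AtPlace.done h1 (by omega) h3
      · rw [if_pos h1]
        exact AtPlace.left (by omega) (h2.crossRight hc)
      · rw [if_neg (by omega)]
        by_cases h3 : (σ i).val = r + c + 1
        · have e : (σ i).val - r - 1 = c := by omega
          rw [e] at h2
          have e' : r + c - r = c := by omega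
          rw [if_pos h3]
          exact AtPlace.done (by omega) (by omega) (by rw [e']; exact Or.inl ⟨h2, hc⟩)
        · rw [if_neg h3]
          exact AtPlace.bottom (by omega) h2
    · rw [crossPerm_of_not_hasCross hc, Equiv.Perm.one_apply]
      rcases ih with ⟨h1, h2⟩ | ⟨h1, h2, h3⟩ | ⟨h1, h2⟩ | ⟨h1, h2⟩
      · exact AtPlace.waiting h1 h2
      · exact AtPlace.done h1 (by omega) h3
      · have e : (σ i).val - r = c := by omega
        exact AtPlace.done (by omega) (by omega) (by rw [e]; exact Or.inr ⟨h2, hc⟩)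
      · by_cases h3 : (σ i).val = r + c + 1
        · have e : (σ i).val - r - 1 = c := by omega
          rw [e] at h2
          exact AtPlace.left (by omega) (h2.elbowRight hc)
        · exact AtPlace.bottom (by omega) h2
  | @row r c σ h hrc ih =>
    have hlt := (σ i).2
    rcases ih with ⟨h1, h2⟩ | ⟨h1, h2, h3⟩ | ⟨h1, h2⟩ | ⟨h1, h2⟩
    · rcases (Nat.lt_succ_iff.1 h1).eq_or_lt with h3 | h3
      · exact AtPlace.left (by omega) (by rw [h2, h3]; exact PipeEnters.start)
      · exact AtPlace.waiting h3 h2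
    · have e : (σ i).val - (r + 1) = (σ i).val - r - 1 := by omega
      rw [e] at h3
      exact AtPlace.bottom (by omega) h3.pipeEnters
    · have e : (σ i).val - r - 1 = c := by omega
      refine AtPlace.bottom (by omega) ?_
      rw [e]
      exact h2.elbowUp fun hc => by have := hc.lt; omega
    · omega

theorem Sweep.pipeExits {σ : Equiv.Perm (Fin n)} (h : Sweep C 0 (n - 1) σ) (i : Fin n) :
    PipeExits C i (σ i) := by
  have hlt := (σ i).2
  rcases h.atPlace i with ⟨h1, h2⟩ | ⟨h1, h2, h3⟩ | ⟨h1, h2⟩ | ⟨h1, h2⟩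
  · omega
  · exact h3
  · have e : (σ i).val = n - 1 := by omega
    rw [e]
    exact Or.inr ⟨h2, fun hc => by have := hc.lt; omega⟩
  · omega

/-- The product of the letters at the crosses in row `r` west of column `c`, in reading order. -/
noncomputable def rowProd (C : Finset (Box n)) (r : ℕ) : ℕ → Equiv.Perm (Fin n)
  | 0 => 1
  | c + 1 => crossPerm C r c * rowProd C r c

theorem rowProd_eq_of_le {r c : ℕ} (hr : r < n) (hc : n - 1 - r ≤ c) :
    rowProd C r c = rowProd C r (n - 1 - r) := by
  induction c, hc using Nat.le_induction with
  | base => rfl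
  | succ c hc ih =>
    rw [rowProd, ih, crossPerm_of_not_hasCross (fun h => by have := h.lt; omega), one_mul]

theorem rowProd_eq_prod (r c : ℕ) :
    rowProd C r c = ((List.range c).reverse.map (crossPerm C r)).prod := by
  induction c with
  | zero => rfl
  | succ c ih => rw [rowProd, ih, List.range_succ]; simp

theorem Sweep.along_row {r : ℕ} {σ : Equiv.Perm (Fin n)} (h : Sweep C r 0 σ) {c : ℕ}
    (hc : c + r + 1 ≤ n) : Sweep C r c (rowProd C r c * σ) := by
  induction c with
  | zero => rwa [rowProd, one_mul]
  | succ c ih =>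
    rw [rowProd, mul_assoc]
    exact (ih (by omega)).box (by omega)

theorem sweep_rows {m : ℕ} (hm : m < n) :
    Sweep C (n - 1 - m) 0
      ((List.range' (n - m) m).map fun r => rowProd C r n).prod := by
  induction m with
  | zero =>
    obtain ⟨k, rfl⟩ : ∃ k, n = k + 1 := ⟨n - 1, by omega⟩
    exact Sweep.start.row (by omega)
  | succ m ih =>
    have h := (ih (by omega)).along_row (c := m) (by omega)
    have e1 : n - (m + 1) + 1 = n - m := by omega
    have e2 : n - 1 - m = n - 1 - (m + 1) + 1 := by omega
    have e3 : n - (m + 1) = n - 1 - m := by omega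
    rw [List.range'_succ, List.map_cons, List.prod_cons, e1, e3,
      rowProd_eq_of_le (by omega) (by omega : n - 1 - (n - 1 - m) ≤ n)]
    have e4 : n - 1 - (n - 1 - m) = m := by omega
    rw [e4]
    rw [e2] at h ⊢
    exact h.row (by omega)

theorem exists_sweep {r c : ℕ} (h : r + c < n) : ∃ σ, Sweep C r c σ := by
  have h1 := sweep_rows (C := C) (m := n - 1 - r) (by omega)
  have e : n - 1 - (n - 1 - r) = r := by omega
  rw [e] at h1
  exact ⟨_, h1.along_row (by omega)⟩

theorem sweep_final (hn : 0 < n) :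
    Sweep C 0 (n - 1) ((List.range n).map fun r => rowProd C r n).prod := by
  have h1 := sweep_rows (C := C) (m := n - 1) (by omega)
  have e : n - 1 - (n - 1) = 0 := by omega
  have e' : n - (n - 1) = 1 := by omega
  rw [e, e'] at h1
  have h2 := h1.along_row (c := n - 1) (by omega)
  have h3 : List.range n = 0 :: List.range' 1 (n - 1) := by
    obtain ⟨k, rfl⟩ : ∃ k, n = k + 1 := ⟨n - 1, by omega⟩
    rw [List.range_eq_range', List.range'_succ]
    rfl
  rw [h3, List.map_cons, List.prod_cons, rowProd_eq_of_le hn (by omega : n - 1 - 0 ≤ n)]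
  exact h2

theorem prod_subword (C : Finset (Box n)) :
    ((subword C).map simpleReflection).prod = ((List.range n).map fun r => rowProd C r n).prod := by
  have hrow : ∀ (r : Fin n) (l : List (Fin n)),
      ((((l.filterMap fun c => if h : r.val + c.val + 1 < n then some (⟨(r, c), h⟩ : Box n)
        else none).filter fun b => b ∈ C).map Box.letter).map simpleReflection).prod =
      (l.map fun c : Fin n => crossPerm C r.val c.val).prod := by
    intro r l
    induction l with
    | nil => rfl
    | cons c l ih =>
      rw [List.map_cons, List.prod_cons, ← ih]
      by_cases h : r.val + c.val + 1 < n
      · rw [List.filterMap_cons_some (b := ⟨(r, c), h⟩) (by rw [dif_pos h])]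
        have hcross : HasCross C r.val c.val ↔ (⟨(r, c), h⟩ : Box n) ∈ C :=
          hasCross_row_col (b := ⟨(r, c), h⟩)
        by_cases hb : (⟨(r, c), h⟩ : Box n) ∈ C
        · rw [List.filter_cons_of_pos (by simpa using hb), List.map_cons, List.map_cons,
            List.prod_cons, crossPerm, dif_pos (hcross.2 hb)]
          rfl
        · rw [List.filter_cons_of_neg (by simpa using hb),
            crossPerm_of_not_hasCross fun h' => hb (hcross.1 h'), one_mul]
      · rw [List.filterMap_cons_none (by rw [dif_neg h]),
          crossPerm_of_not_hasCross fun h' => h h'.lt, one_mul]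
  have hrows : ∀ l : List (Fin n),
      ((((l.flatMap fun r => (List.finRange n).reverse.filterMap fun c =>
        if h : r.val + c.val + 1 < n then some (⟨(r, c), h⟩ : Box n) else none).filter
          fun b => b ∈ C).map Box.letter).map simpleReflection).prod =
      (l.map fun r : Fin n => rowProd C r.val n).prod := by
    intro l
    induction l with
    | nil => rfl
    | cons r l ih =>
      rw [List.flatMap_cons, List.filter_append, List.map_append, List.map_append,
        List.prod_append, ih, hrow, List.map_cons, List.prod_cons, rowProd_eq_prod,
        ← List.map_coe_finRange_eq_range, ← List.map_reverse, List.map_map]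
      rfl
  rw [subword, readingOrder, hrows, ← List.map_coe_finRange_eq_range, List.map_map]
  rfl

/-- The product of the subword at the crosses sends each pipe to the column where it leaves. -/
theorem pipeExits_prod_subword (C : Finset (Box n)) (i : Fin n) :
    PipeExits C i (((subword C).map simpleReflection).prod i) := by
  rw [prod_subword]
  exact (sweep_final (Nat.zero_lt_of_lt i.2)).pipeExits i

theorem prod_subword_eq_iff {w : Equiv.Perm (Fin n)} :
    ((subword C).map simpleReflection).prod = w ↔ ∀ i : Fin n, PipeExits C i (w i) := by
  constructor
  · rintro rfl i
    exact pipeExits_prod_subword C i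
  · intro h
    ext i
    have h1 := pipeExits_prod_subword C (((subword C).map simpleReflection).prod.symm (w i))
    rw [Equiv.apply_symm_apply] at h1
    have h2 := Fin.ext (h1.injective (h i))
    rw [Equiv.symm_apply_eq] at h2
    rw [h2]

/-- Two pipes that do not cross in the region read so far keep their order. -/
theorem Sweep.lt_or_pipesCrossAt {r c : ℕ} {σ : Equiv.Perm (Fin n)} (h : Sweep C r c σ)
    {i j : Fin n} (hij : i < j) : σ i < σ j ∨ ∃ b, PipesCrossAt C i j b := by
  induction h with
  | start => exact Or.inl hij
  | @box r c σ h hrc ih =>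
    rcases ih with ih | ih
    swap
    · exact Or.inr ih
    by_cases hc : HasCross C r c
    swap
    · rw [crossPerm_of_not_hasCross hc, one_mul]
      exact Or.inl ih
    by_cases hboth : (σ i).val = r + c ∧ (σ j).val = r + c + 1
    · right
      have hi : PipeEnters C i r c Side.left := by
        rcases h.atPlace i with ⟨h1, h2⟩ | ⟨h1, h2, h3⟩ | ⟨h1, h2⟩ | ⟨h1, h2⟩
        · omega
        · omega
        · exact h2
        · omega
      have hj : PipeEnters C j r c Side.bottom := by
        rcases h.atPlace j with ⟨h1, h2⟩ | ⟨h1, h2, h3⟩ | ⟨h1, h2⟩ | ⟨h1, h2⟩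
        · omega
        · omega
        · omega
        · have e : (σ j).val - r - 1 = c := by omega
          rwa [e] at h2
      obtain ⟨b, hb, rfl, rfl⟩ := hc
      exact ⟨b, hb, ⟨_, hi⟩, ⟨_, hj⟩⟩
    · left
      rw [Fin.lt_def] at ih ⊢
      rw [Equiv.Perm.mul_apply, Equiv.Perm.mul_apply, crossPerm_val hc, crossPerm_val hc]
      split_ifs <;> omega
  | row _ _ ih => exact ih

theorem exists_pipesCrossAt_of_gt {w : Equiv.Perm (Fin n)} (hC : ∀ i : Fin n, PipeExits C i (w i))
    {i j : Fin n} (hij : i < j) (hw : w j < w i) : ∃ b, PipesCrossAt C i j b := by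
  have h := sweep_final (C := C) (Nat.zero_lt_of_lt i.2)
  rw [← prod_subword, prod_subword_eq_iff.2 hC] at h
  exact (h.lt_or_pipesCrossAt hij).resolve_left hw.not_gt

/-- In each cross, two different pipes meet. -/
theorem exists_pipesCrossAt {b : Box n} (hb : b ∈ C) :
    ∃ i j : Fin n, i < j ∧ PipesCrossAt C i j b := by
  have hlt := b.row_add_col_lt
  obtain ⟨σ, hσ⟩ := exists_sweep (C := C) (r := b.row) (c := b.col) (by omega)
  have hp : ∃ p : Fin n, (σ p).val = b.row + b.col :=
    ⟨σ.symm ⟨b.row + b.col, by omega⟩, by rw [Equiv.apply_symm_apply]⟩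
  have hq : ∃ q : Fin n, (σ q).val = b.row + b.col + 1 :=
    ⟨σ.symm ⟨b.row + b.col + 1, by omega⟩, by rw [Equiv.apply_symm_apply]⟩
  obtain ⟨p, hp⟩ := hp
  obtain ⟨q, hq⟩ := hq
  have hpe : ∃ s, PipeEnters C p b.row b.col s := by
    rcases hσ.atPlace p with ⟨h1, h2⟩ | ⟨h1, h2, h3⟩ | ⟨h1, h2⟩ | ⟨h1, h2⟩
    · omega
    · omega
    · exact ⟨_, h2⟩
    · omega
  have hqe : ∃ s, PipeEnters C q b.row b.col s := by
    rcases hσ.atPlace q with ⟨h1, h2⟩ | ⟨h1, h2, h3⟩ | ⟨h1, h2⟩ | ⟨h1, h2⟩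
    · omega
    · omega
    · omega
    · have e : (σ q).val - b.row - 1 = b.col := by omega
      rw [e] at h2
      exact ⟨_, h2⟩
  have hne : p ≠ q := by
    rintro rfl
    omega
  rcases lt_or_gt_of_ne hne with h | h
  · exact ⟨p, q, h, hb, hpe, hqe⟩
  · exact ⟨q, p, h, hb, hqe, hpe⟩

theorem PipesCrossAt.unique {i j i' j' : ℕ} {b : Box n} (h : PipesCrossAt C i j b)
    (h' : PipesCrossAt C i' j' b) (hij : i ≠ j) (hij' : i' ≠ j') :
    (i = i' ∧ j = j') ∨ (i = j' ∧ j = i') := by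
  obtain ⟨-, ⟨s, h1⟩, ⟨t, h2⟩⟩ := h
  obtain ⟨-, ⟨s', h3⟩, ⟨t', h4⟩⟩ := h'
  have hst : s ≠ t := fun e => hij (by subst e; exact h1.injective h2)
  have hst' : s' ≠ t' := fun e => hij' (by subst e; exact h3.injective h4)
  by_cases e : s = s'
  · subst e
    have e' : t = t' := by cases s <;> cases t <;> cases t' <;> simp_all
    subst e'
    exact Or.inl ⟨h1.injective h3, h2.injective h4⟩
  · have e1 : s = t' := by cases s <;> cases s' <;> cases t' <;> simp_all
    have e2 : t = s' := by cases s <;> cases s' <;> cases t <;> simp_all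
    subst e1 e2
    exact Or.inr ⟨h1.injective h4, h2.injective h3⟩

/-! ### Inversions -/

/-- The inversions `i < j` of a permutation, as the boxes of the edges `(i, j)`. -/
def inversions (w : Equiv.Perm (Fin n)) : Finset (Box n) :=
  Finset.univ.filter fun b => w b.tgt < w b.src

theorem mem_inversions {w : Equiv.Perm (Fin n)} {b : Box n} :
    b ∈ inversions w ↔ w b.tgt < w b.src := by
  simp [inversions]

theorem card_inversions_le_length (L : List (Fin (n - 1))) :
    (inversions (L.map simpleReflection).prod).card ≤ L.length := by
  classical
  induction L with
  | nil =>
    rw [List.length_nil, Nat.le_zero, Finset.card_eq_zero]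
    refine Finset.eq_empty_of_forall_notMem fun b hb => ?_
    rw [mem_inversions] at hb
    exact hb.not_gt b.src_lt_tgt
  | cons k L ih =>
    rw [List.map_cons, List.prod_cons, List.length_cons]
    generalize (L.map simpleReflection).prod = p at ih
    by_cases hnew : ∃ b : Box n, (p b.src).val = k ∧ (p b.tgt).val = k + 1
    · obtain ⟨b₀, h1, h2⟩ := hnew
      refine (Finset.card_le_card (t := insert b₀ (inversions p)) fun b hb => ?_).trans
        ((Finset.card_insert_le _ _).trans (Nat.succ_le_succ ih))
      rw [Finset.mem_insert, mem_inversions]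
      by_contra hcon
      rw [not_or] at hcon
      refine hcon.1 (Box.ext_src_tgt (p.injective (Fin.ext ?_)) (p.injective (Fin.ext ?_)))
      all_goals
        have h3 := hcon.2
        rw [mem_inversions, Equiv.Perm.mul_apply, Equiv.Perm.mul_apply, Fin.lt_def,
          simpleReflection_val, simpleReflection_val] at hb
        rw [Fin.lt_def] at h3
        split_ifs at hb <;> omega
    · refine (Finset.card_le_card (t := inversions p) fun b hb => ?_).trans (ih.trans (by omega))
      rw [mem_inversions]
      by_contra hcon
      refine hnew ⟨b, ?_⟩
      have hne : (p b.src).val ≠ (p b.tgt).val := fun h =>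
        b.src_lt_tgt.ne (p.injective (Fin.ext h))
      rw [mem_inversions, Equiv.Perm.mul_apply, Equiv.Perm.mul_apply, Fin.lt_def,
        simpleReflection_val, simpleReflection_val] at hb
      rw [Fin.lt_def] at hcon
      split_ifs at hb <;> omega

theorem mem_inversions_permOneRev {b : Box n} :
    b ∈ inversions (permOneRev n) ↔ b.src.val ≠ 0 := by
  have hlt := Fin.lt_def.1 b.src_lt_tgt
  have h2 := b.tgt.2
  rw [mem_inversions, Fin.lt_def, permOneRev_val (i := b.tgt) (by omega)]
  by_cases h : b.src.val = 0
  · rw [permOneRev_zero h]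
    omega
  · rw [permOneRev_val h]
    omega

/-- The edges at the first vertex form a maximal noncrossing alternating set. -/
theorem maximal_compl_inversions_permOneRev :
    Maximal IsNCAlt (inversions (permOneRev n))ᶜ := by
  have hmem : ∀ b : Box n, b ∈ (inversions (permOneRev n))ᶜ ↔ b.src.val = 0 := fun b => by
    rw [Finset.mem_compl, mem_inversions_permOneRev, not_not]
  constructor
  · intro b hb b' hb' h1
    rw [hmem] at hb hb'
    rw [Fin.lt_def] at h1
    omega
  · intro F hF hle b hb
    rw [hmem]
    by_contra h0
    have hlt : (⟨0, Nat.zero_lt_of_lt b.src.2⟩ : Fin n) < b.src :=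
      Fin.lt_def.2 (Nat.pos_of_ne_zero h0)
    exact hF (edgeBox hlt) (hle ((hmem _).2 rfl)) b hb (by simpa) (by simp)
      (by simpa using b.src_lt_tgt)

theorem card_compl_of_maximal (hn : 0 < n) {F : Finset (Box n)} (hF : Maximal IsNCAlt F) :
    Fᶜ.card = (inversions (permOneRev n)).card := by
  have h1 := card_of_maximal hn hF
  have h2 := card_of_maximal hn (maximal_compl_inversions_permOneRev (n := n))
  have h3 := Finset.card_add_card_compl F
  have h4 := Finset.card_add_card_compl (inversions (permOneRev n))
  omega

/-! ### Reduced pipe dreams and reduced subwords -/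

theorem isReducedDecomposition_of_maximal (hn : 0 < n) {F : Finset (Box n)}
    (hF : Maximal IsNCAlt F) : IsReducedDecomposition (subword Fᶜ) (permOneRev n) := by
  classical
  refine ⟨prod_subword_eq_iff.2 (pipeExits_of_maximal hF), fun L' hL' => ?_⟩
  have h1 := card_inversions_le_length L'
  rw [hL', ← card_compl_of_maximal hn hF] at h1
  refine le_trans ?_ h1
  have hnodup : (readingOrder n).Nodup := by
    rw [readingOrder, List.nodup_flatMap]
    refine ⟨fun r _ => ?_, ?_⟩
    · refine List.Nodup.filterMap ?_ (List.nodup_reverse.2 (List.nodup_finRange n))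
      intro c c' b hb hb'
      rw [Option.mem_def, Option.dite_none_right_eq_some] at hb hb'
      obtain ⟨_, hb⟩ := hb
      obtain ⟨_, hb'⟩ := hb'
      have h := (Option.some.inj hb).trans (Option.some.inj hb').symm
      exact (Prod.ext_iff.1 (Subtype.ext_iff.1 h)).2
    · refine (List.nodup_finRange n).pairwise_of_forall_ne fun r _ r' _ hne => ?_
      rw [Function.onFun, List.disjoint_left]
      intro b hb hb'
      rw [List.mem_filterMap] at hb hb'
      obtain ⟨c, -, hb⟩ := hb
      obtain ⟨c', -, hb'⟩ := hb'
      rw [Option.dite_none_right_eq_some] at hb hb'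
      obtain ⟨_, hb⟩ := hb
      obtain ⟨_, hb'⟩ := hb'
      have h := (Option.some.inj hb).trans (Option.some.inj hb').symm
      exact hne (Prod.ext_iff.1 (Subtype.ext_iff.1 h)).1
  rw [subword, List.length_map, ← List.toFinset_card_of_nodup (hnodup.filter _)]
  refine Finset.card_le_card fun b hb => ?_
  rw [List.mem_toFinset, List.mem_filter] at hb
  simpa using hb.2

theorem containsPerm_compl_iff (hn : 0 < n) {F : Finset (Box n)} :
    ContainsPerm Fᶜ (permOneRev n) ↔ IsNCAlt F := by
  constructor
  · rintro ⟨R, hR, hprod, -⟩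
    exact (isNCAlt_compl_of_pipeExits (prod_subword_eq_iff.1 hprod)).mono
      (Finset.subset_compl_comm.1 hR)
  · intro h
    obtain ⟨M, hFM, hM⟩ := h.exists_maximal
    exact ⟨Mᶜ, Finset.compl_subset_compl.2 hFM, isReducedDecomposition_of_maximal hn hM⟩

/-- Every inverted pair of pipes crosses somewhere; there are as many crosses as such pairs, so no
pair crosses twice. -/
theorem isReducedPipeDream_of_maximal (hn : 0 < n) {F : Finset (Box n)}
    (hF : Maximal IsNCAlt F) : IsReducedPipeDream (permOneRev n) Fᶜ := by
  classical
  have hexit := pipeExits_of_maximal hF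
  refine ⟨hexit, ?_⟩
  have hex : ∀ e ∈ inversions (permOneRev n), ∃ b, PipesCrossAt Fᶜ e.src e.tgt b := fun e he =>
    exists_pipesCrossAt_of_gt hexit e.src_lt_tgt (mem_inversions.1 he)
  choose! X hX using hex
  have hsurj : ∀ b ∈ Fᶜ, ∃ e ∈ inversions (permOneRev n), X e = b := by
    have himg : (inversions (permOneRev n)).image X = Fᶜ := by
      refine Finset.eq_of_subset_of_card_le ?_ ?_
      · intro b hb
        obtain ⟨e, he, rfl⟩ := Finset.mem_image.1 hb
        exact (hX e he).1
      · rw [Finset.card_image_of_injOn, card_compl_of_maximal hn hF]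
        intro e he e' he' h
        have h1 := hX e he
        rw [h] at h1
        have h2 := Fin.lt_def.1 e.src_lt_tgt
        have h3 := Fin.lt_def.1 e'.src_lt_tgt
        rcases h1.unique (hX e' he') h2.ne h3.ne with ⟨h4, h5⟩ | ⟨h4, h5⟩
        · exact Box.ext_src_tgt (Fin.ext h4) (Fin.ext h5)
        · omega
    intro b hb
    rw [← himg] at hb
    exact Finset.mem_image.1 hb
  intro i j hij b b' hb hb'
  have hij' : i.val ≠ j.val := fun h => hij (Fin.ext h)
  obtain ⟨e, he, rfl⟩ := hsurj b hb.1
  obtain ⟨e', he', rfl⟩ := hsurj b' hb'.1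
  have h2 := Fin.lt_def.1 e.src_lt_tgt
  have h3 := Fin.lt_def.1 e'.src_lt_tgt
  congr 1
  have h4 := (hX e he).unique hb h2.ne hij'
  have h5 := (hX e' he').unique hb' h3.ne hij'
  exact Box.ext_src_tgt (Fin.ext (by omega)) (Fin.ext (by omega))

/-- The pipe `0` meets no cross. -/
theorem PipeEnters.eq_zero_of_pipeExits_zero (hexit : PipeExits C 0 0) {i r c : ℕ} {s : Side}
    (h : PipeEnters C i r c s) (hi : i = 0) : r = 0 ∧ c = 0 ∧ ¬ HasCross C 0 0 := by
  have h00 : ¬ HasCross C 0 0 := by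
    rcases hexit with ⟨h1, -⟩ | ⟨-, h1⟩
    · exact absurd h1.row_lt (Nat.not_lt_zero _)
    · exact h1
  induction h with
  | start => exact ⟨hi, rfl, h00⟩
  | crossRight _ hc ih =>
    obtain ⟨rfl, rfl, -⟩ := ih
    exact absurd hc h00
  | elbowRight h _ _ => exact absurd h.row_lt (by omega)
  | crossUp h _ _ => exact absurd h.row_le.1 (by omega)
  | elbowUp h _ _ => exact absurd h.row_le.1 (by omega)

theorem maximal_compl_of_isReducedPipeDream (hn : 0 < n)
    (hC : IsReducedPipeDream (permOneRev n) C) : Maximal IsNCAlt Cᶜ := by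
  classical
  obtain ⟨hexit, hred⟩ := hC
  obtain ⟨M, hCM, hM⟩ := (isNCAlt_compl_of_pipeExits hexit).exists_maximal
  have hexit0 : PipeExits C 0 0 := by
    have h := hexit ⟨0, hn⟩
    rwa [permOneRev_zero rfl] at h
  have hex : ∀ b ∈ C, ∃ e ∈ inversions (permOneRev n), PipesCrossAt C e.src e.tgt b := by
    intro b hb
    obtain ⟨i, j, hij, h⟩ := exists_pipesCrossAt hb
    refine ⟨edgeBox hij, mem_inversions_permOneRev.2 fun h0 => ?_, by simpa⟩
    rw [edgeBox_src] at h0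
    obtain ⟨-, ⟨s, hs⟩, -⟩ := h
    obtain ⟨h1, h2, h3⟩ := hs.eq_zero_of_pipeExits_zero hexit0 h0
    rw [← hasCross_row_col, h1, h2] at hb
    exact h3 hb
  choose! e he he' using hex
  have hcard : C.card ≤ (inversions (permOneRev n)).card := by
    refine Finset.card_le_card_of_injOn e he ?_
    intro b hb b' hb' h
    have h1 := he' b hb
    rw [h] at h1
    exact hred _ _ (e b').src_lt_tgt.ne b b' h1 (he' b' hb')
  rw [← card_compl_of_maximal hn hM] at hcard
  have h1 := Finset.eq_of_subset_of_card_le (compl_le_of_compl_le hCM) hcard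
  rwa [← h1, compl_compl]

theorem isReducedPipeDream_iff (hn : 0 < n) :
    IsReducedPipeDream (permOneRev n) C ↔ Maximal IsNCAlt Cᶜ :=
  ⟨maximal_compl_of_isReducedPipeDream hn, fun h => by
    simpa using isReducedPipeDream_of_maximal hn h⟩

end Words

/-! ### The canonical triangulation -/

theorem mem_faces_pipeDreamComplex {n : ℕ} (hn : 0 < n) {F : Finset (Box n)} :
    F ∈ (pipeDreamComplex (permOneRev n)).faces ↔ F.Nonempty ∧ IsNCAlt F :=
  and_congr_right fun _ => containsPerm_compl_iff hn

theorem nonempty_of_maximal {n : ℕ} (hn : 2 ≤ n) {F : Finset (Box n)} (hF : Maximal IsNCAlt F) :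
    F.Nonempty := by
  have := card_of_maximal (by omega) hF
  exact Finset.card_pos.1 (by omega)

theorem maximal_face_iff {n : ℕ} (hn : 2 ≤ n) {F : Finset (Box n)} :
    Maximal (fun F' => F' ∈ (pipeDreamComplex (permOneRev n)).faces) F ↔ Maximal IsNCAlt F := by
  simp only [mem_faces_pipeDreamComplex (n := n) (by omega)]
  constructor
  · rintro ⟨⟨h1, h2⟩, h3⟩
    exact ⟨h2, fun F' hF' hle => h3 ⟨h1.mono hle, hF'⟩ hle⟩
  · intro h
    exact ⟨⟨nonempty_of_maximal hn h, h.1⟩, fun F' hF' hle => h.2 hF'.2 hle⟩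

section Triangulation

variable {n : ℕ} {f : Module.Dual ℝ (Fin n → ℝ)} {β : ℝ} {V : Set (Fin n → ℝ)}

theorem rootPolytope_inter_vertexFigure (hβ : 0 < β)
    (hf : ∀ b : Box n, β < f (root b.src b.tgt))
    (hV : V = rootPolytope (SimpleGraph.pathGraph n) ∩ {x | f x = β}) (F : Finset (Box n)) :
    rootPolytope (boxGraph F) ∩ V = convexHull ℝ (slicePoint f β '' (F : Set (Box n))) := by
  rw [hV, ← Set.inter_assoc, Set.inter_eq_left.2 (rootPolytope_subset_pathGraph _),
    rootPolytope_inter_eq hβ hf]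

theorem mem_canonicalFaces (hn : 0 < n) (hβ : 0 < β) (hf : ∀ b : Box n, β < f (root b.src b.tgt))
    (hV : V = rootPolytope (SimpleGraph.pathGraph n) ∩ {x | f x = β})
    {s : Finset (Fin n → ℝ)} :
    s ∈ canonicalFaces V ↔ ∃ F : Finset (Box n), F.Nonempty ∧ IsNCAlt F ∧
      (s : Set (Fin n → ℝ)) = slicePoint f β '' (F : Set (Box n)) := by
  classical
  constructor
  · rintro ⟨hs, T, hT, hsub⟩
    rw [← boxGraph_graphBoxes T] at hT hsub
    have hmax := (maximal_isNCAlt_iff hn).2 hT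
    rw [rootPolytope_inter_vertexFigure hβ hf hV,
      extremePoints_convexHull_slicePoint hβ hf hmax.1, Finset.subset_set_image_iff] at hsub
    obtain ⟨F, hF, rfl⟩ := hsub
    exact ⟨F, Finset.image_nonempty.1 hs, hmax.1.mono (by exact_mod_cast hF), Finset.coe_image⟩
  · rintro ⟨F, hF, hnc, hs⟩
    obtain ⟨M, hFM, hM⟩ := hnc.exists_maximal
    refine ⟨?_, boxGraph M, (maximal_isNCAlt_iff hn).1 hM, ?_⟩
    · rw [← Finset.coe_nonempty, hs]
      exact (Finset.coe_nonempty.2 hF).image _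
    · rw [rootPolytope_inter_vertexFigure hβ hf hV,
        extremePoints_convexHull_slicePoint hβ hf hM.1, hs]
      exact Set.image_mono (by exact_mod_cast hFM)

/-- The canonical triangulation of a vertex figure. -/
noncomputable def canonicalTriangulation (hn : 0 < n) (hβ : 0 < β)
    (hf : ∀ b : Box n, β < f (root b.src b.tgt))
    (hV : V = rootPolytope (SimpleGraph.pathGraph n) ∩ {x | f x = β}) :
    Geometry.SimplicialComplex ℝ (Fin n → ℝ) where
  faces := canonicalFaces V
  isRelLowerSet_faces := by
    rintro s ⟨hs, T, hT, hsub⟩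
    refine ⟨hs, fun t hts ht => ⟨ht, T, hT, ?_⟩⟩
    exact (Finset.coe_subset.2 hts).trans hsub
  indep := by
    intro s hs
    obtain ⟨F, -, hF, hsF⟩ := (mem_canonicalFaces hn hβ hf hV).1 hs
    have h := affineIndependent_slicePoint hβ hf hF
    rw [← hsF] at h
    exact h
  inter_subset_convexHull := by
    classical
    intro s t hs ht x hx
    obtain ⟨F, -, hF, hsF⟩ := (mem_canonicalFaces hn hβ hf hV).1 hs
    obtain ⟨F', -, hF', htF⟩ := (mem_canonicalFaces hn hβ hf hV).1 ht
    rw [hsF, htF] at hx ⊢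
    rw [← Set.image_inter (slicePoint_injective hβ hf), ← Finset.coe_inter]
    refine mem_convexHull_slicePoint_of_forall hβ hf (S := {F, F'}) ⟨F, Or.inl rfl⟩ ?_ ?_ ?_
    · rintro _ (rfl | rfl)
      · exact hF
      · exact hF'
    · rintro _ (rfl | rfl)
      · exact hx.1
      · exact hx.2
    · intro b hb
      exact Finset.mem_inter.2 ⟨hb _ (Or.inl rfl), hb _ (Or.inr rfl)⟩

theorem space_canonicalTriangulation (hn : 0 < n) (hβ : 0 < β)
    (hf : ∀ b : Box n, β < f (root b.src b.tgt))
    (hV : V = rootPolytope (SimpleGraph.pathGraph n) ∩ {x | f x = β}) :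
    (canonicalTriangulation hn hβ hf hV).space = V := by
  classical
  ext x
  rw [Geometry.SimplicialComplex.mem_space_iff]
  constructor
  · rintro ⟨s, hs, hx⟩
    obtain ⟨F, -, -, hsF⟩ := (mem_canonicalFaces hn hβ hf hV).1 hs
    rw [hsF, ← rootPolytope_inter_vertexFigure hβ hf hV] at hx
    exact hx.2
  · intro hx
    have hx' := hx
    rw [hV] at hx'
    obtain ⟨F, hF, hne, hxF⟩ := exists_isNCAlt_mem_convexHull hβ hf hx'.1 hx'.2
    refine ⟨F.image (slicePoint f β), ?_, by rwa [Finset.coe_image]⟩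
    exact (mem_canonicalFaces hn hβ hf hV).2 ⟨F, hne, hF, Finset.coe_image⟩

theorem mem_facets_canonicalTriangulation (hn : 2 ≤ n) (hβ : 0 < β)
    (hf : ∀ b : Box n, β < f (root b.src b.tgt))
    (hV : V = rootPolytope (SimpleGraph.pathGraph n) ∩ {x | f x = β})
    {s : Finset (Fin n → ℝ)} :
    s ∈ (canonicalTriangulation (by omega) hβ hf hV).facets ↔ ∃ F : Finset (Box n),
      Maximal IsNCAlt F ∧ (s : Set (Fin n → ℝ)) = slicePoint f β '' (F : Set (Box n)) := by
  classical
  have hn' : 0 < n := by omega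
  rw [Geometry.SimplicialComplex.mem_facets]
  constructor
  · rintro ⟨hs, hmax⟩
    obtain ⟨F, -, hF, hsF⟩ := (mem_canonicalFaces hn' hβ hf hV).1 hs
    obtain ⟨M, hFM, hM⟩ := hF.exists_maximal
    refine ⟨M, hM, ?_⟩
    have h := hmax (M.image (slicePoint f β)) ((mem_canonicalFaces hn' hβ hf hV).2
      ⟨M, nonempty_of_maximal hn hM, hM.1, Finset.coe_image⟩) ?_
    · rw [h, Finset.coe_image]
    · rw [← Finset.coe_subset, hsF, Finset.coe_image]
      exact Set.image_mono (by exact_mod_cast hFM)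
  · rintro ⟨F, hF, hsF⟩
    refine ⟨(mem_canonicalFaces hn' hβ hf hV).2 ⟨F, nonempty_of_maximal hn hF, hF.1, hsF⟩, ?_⟩
    intro t ht hst
    obtain ⟨F', -, hF', htF⟩ := (mem_canonicalFaces hn' hβ hf hV).1 ht
    rw [← Finset.coe_subset, hsF, htF,
      Set.image_subset_image_iff (slicePoint_injective hβ hf), Finset.coe_subset] at hst
    have h := hst.antisymm (hF.2 hF' hst)
    rw [← Finset.coe_inj, hsF, htF, h]

end Triangulation

end PipeRoot

/-- The canonical triangulation of the vertex figure of the root polytope of the path at `0` is a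
geometric realization of the pipe dream complex of the permutation `1 n n-1 ⋯ 2`. -/
theorem theorem5p3 (n : ℕ) (hn : 2 ≤ n) :
    -- vertex figures of the root polytope at `0` exist, and for each of them:
    (∃ V, PipeRoot.IsVertexFigure (PipeRoot.rootPolytope (SimpleGraph.pathGraph n)) 0 V) ∧
    ∀ V : Set (Fin n → ℝ),
      PipeRoot.IsVertexFigure (PipeRoot.rootPolytope (SimpleGraph.pathGraph n)) 0 V →
      -- the canonical triangulation `K` is a triangulation of `V`, of pure dimension `n - 2`
      ∃ K : Geometry.SimplicialComplex ℝ (Fin n → ℝ),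
        K.faces = PipeRoot.canonicalFaces V ∧
        K.space = V ∧
        (∀ s ∈ K.facets, s.card = n - 1) ∧
        -- the top simplices are indexed by the noncrossing alternating spanning trees
        Set.BijOn (fun T => PipeRoot.rootPolytope T ∩ V) (PipeRoot.ncAltTrees n)
          ((fun s : Finset (Fin n → ℝ) => convexHull ℝ (s : Set (Fin n → ℝ))) '' K.facets) ∧
        -- reduced pipe dreams index the top simplices of the pipe dream complex
        Set.BijOn (fun C : Finset (PipeRoot.Box n) => Cᶜ)
          {C | PipeRoot.IsReducedPipeDream (PipeRoot.permOneRev n) C}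
          {F | Maximal
            (fun F' => F' ∈ (PipeRoot.pipeDreamComplex (PipeRoot.permOneRev n)).faces) F} ∧
        -- they correspond to the trees through the positions of their elbows
        Set.BijOn PipeRoot.elbowGraph
          {C | PipeRoot.IsReducedPipeDream (PipeRoot.permOneRev n) C} (PipeRoot.ncAltTrees n) ∧
        -- `K` realizes the pipe dream complex, compatibly with this correspondence
        (∃ φ : PipeRoot.Box n → (Fin n → ℝ),
          PipeRoot.IsGeometricRealization K
            (PipeRoot.pipeDreamComplex (PipeRoot.permOneRev n)) φ ∧
          (∀ F ∈ (PipeRoot.pipeDreamComplex (PipeRoot.permOneRev n)).faces,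
            convexHull ℝ (φ '' (F : Set (PipeRoot.Box n))) =
              PipeRoot.rootPolytope (PipeRoot.boxGraph F) ∩ V) ∧
          -- and compatibly with intersections of faces
          (∀ S : Finset (Finset (PipeRoot.Box n)), S.Nonempty →
            (∀ C ∈ S, PipeRoot.IsReducedPipeDream (PipeRoot.permOneRev n) C) →
            PipeRoot.elbowGraph (S.biUnion id) = ⨅ C ∈ S, PipeRoot.elbowGraph C ∧
            (⋂ C ∈ S, PipeRoot.rootPolytope (PipeRoot.elbowGraph C)) ∩ V =
              PipeRoot.rootPolytope (⨅ C ∈ S, PipeRoot.elbowGraph C) ∩ V ∧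
            (⋂ C ∈ S, PipeRoot.rootPolytope (PipeRoot.elbowGraph C)) ∩ V =
              convexHull ℝ
                (φ '' (((S.biUnion id)ᶜ : Finset (PipeRoot.Box n)) : Set (PipeRoot.Box n))))) := by
  have hn0 : 0 < n := by omega
  refine ⟨PipeRoot.exists_isVertexFigure hn, fun V hVfig => ?_⟩
  obtain ⟨f, β, hβ, hf, hV⟩ := hVfig.exists_slice
  have hslice := PipeRoot.rootPolytope_inter_vertexFigure hβ hf hV
  have hinj := PipeRoot.slicePoint_injective hβ hf
  have hfaces : ∀ {s}, s ∈ PipeRoot.canonicalFaces V ↔ _ :=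
    PipeRoot.mem_canonicalFaces hn0 hβ hf hV
  have hfacets : ∀ {s}, s ∈ (PipeRoot.canonicalTriangulation hn0 hβ hf hV).facets ↔ _ :=
    PipeRoot.mem_facets_canonicalTriangulation hn hβ hf hV
  refine ⟨PipeRoot.canonicalTriangulation hn0 hβ hf hV, rfl,
    PipeRoot.space_canonicalTriangulation hn0 hβ hf hV, ?_, ⟨?_, ?_, ?_⟩, ⟨?_, ?_, ?_⟩,
    ⟨?_, ?_, ?_⟩, PipeRoot.slicePoint f β, ⟨hinj.injOn, fun s => ?_⟩,
    fun F _ => (hslice F).symm, ?_⟩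
  · intro s hs
    obtain ⟨F, hF, hsF⟩ := hfacets.1 hs
    have h1 := PipeRoot.card_of_maximal hn0 hF
    rw [← Set.ncard_coe_finset, hsF, Set.ncard_image_of_injective _ hinj, Set.ncard_coe_finset]
    omega
  · intro T hT
    rw [← PipeRoot.boxGraph_graphBoxes T] at hT
    refine ⟨(PipeRoot.graphBoxes T).image (PipeRoot.slicePoint f β), hfacets.2
      ⟨_, (PipeRoot.maximal_isNCAlt_iff hn0).2 hT, Finset.coe_image⟩, ?_⟩
    simp only
    rw [Finset.coe_image, ← hslice, PipeRoot.boxGraph_graphBoxes]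
  · intro T hT T' hT' h
    rw [← PipeRoot.boxGraph_graphBoxes T] at hT h ⊢
    rw [← PipeRoot.boxGraph_graphBoxes T'] at hT' h ⊢
    simp only [hslice] at h
    have h1 := congrArg (fun s => s.extremePoints ℝ) h
    rw [PipeRoot.extremePoints_convexHull_slicePoint hβ hf
        ((PipeRoot.maximal_isNCAlt_iff hn0).2 hT).1,
      PipeRoot.extremePoints_convexHull_slicePoint hβ hf
        ((PipeRoot.maximal_isNCAlt_iff hn0).2 hT').1,
      Set.image_eq_image hinj, Finset.coe_inj] at h1
    rw [h1]
  · rintro _ ⟨s, hs, rfl⟩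
    obtain ⟨F, hF, hsF⟩ := hfacets.1 hs
    refine ⟨PipeRoot.boxGraph F, (PipeRoot.maximal_isNCAlt_iff hn0).1 hF, ?_⟩
    simp only
    rw [hslice, hsF]
  · intro C hC
    exact (PipeRoot.maximal_face_iff hn).2 ((PipeRoot.isReducedPipeDream_iff hn0).1 hC)
  · exact compl_injective.injOn
  · intro F hF
    refine ⟨Fᶜ, (PipeRoot.isReducedPipeDream_iff hn0).2 ?_, compl_compl F⟩
    rw [compl_compl]
    exact (PipeRoot.maximal_face_iff hn).1 hF
  · intro C hC
    exact (PipeRoot.maximal_isNCAlt_iff hn0).1 ((PipeRoot.isReducedPipeDream_iff hn0).1 hC)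
  · exact (PipeRoot.boxGraph_injective.comp compl_injective).injOn
  · intro T hT
    rw [← PipeRoot.boxGraph_graphBoxes T] at hT
    refine ⟨(PipeRoot.graphBoxes T)ᶜ, (PipeRoot.isReducedPipeDream_iff hn0).2 ?_, ?_⟩
    · rw [compl_compl]
      exact (PipeRoot.maximal_isNCAlt_iff hn0).2 hT
    · rw [PipeRoot.elbowGraph, compl_compl, PipeRoot.boxGraph_graphBoxes]
  · refine hfaces.trans ⟨?_, ?_⟩
    · rintro ⟨F, h1, h2, h3⟩
      exact ⟨F, (PipeRoot.mem_faces_pipeDreamComplex hn0).2 ⟨h1, h2⟩, h3⟩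
    · rintro ⟨F, h1, h2⟩
      exact ⟨F, ((PipeRoot.mem_faces_pipeDreamComplex hn0).1 h1).1,
        ((PipeRoot.mem_faces_pipeDreamComplex hn0).1 h1).2, h2⟩
  · intro S hS hSC
    have hgraph := PipeRoot.elbowGraph_biUnion S hS
    have hhull : PipeRoot.rootPolytope (⨅ C ∈ S, PipeRoot.elbowGraph C) ∩ V =
        convexHull ℝ (PipeRoot.slicePoint f β ''
          (((S.biUnion id)ᶜ : Finset (PipeRoot.Box n)) : Set (PipeRoot.Box n))) := by
      rw [← hgraph, PipeRoot.elbowGraph, hslice]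
    have hinter : (⋂ C ∈ S, PipeRoot.rootPolytope (PipeRoot.elbowGraph C)) ∩ V =
        convexHull ℝ (PipeRoot.slicePoint f β ''
          (((S.biUnion id)ᶜ : Finset (PipeRoot.Box n)) : Set (PipeRoot.Box n))) := by
      ext x
      constructor
      · rintro ⟨hx, hxV⟩
        refine PipeRoot.mem_convexHull_slicePoint_of_forall hβ hf
          (S := {F | ∃ C ∈ S, F = Cᶜ}) ?_ ?_ ?_ ?_
        · obtain ⟨C, hC⟩ := hS
          exact ⟨Cᶜ, C, hC, rfl⟩
        · rintro _ ⟨C, hC, rfl⟩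
          exact ((PipeRoot.isReducedPipeDream_iff hn0).1 (hSC C hC)).1
        · rintro _ ⟨C, hC, rfl⟩
          rw [← hslice]
          exact ⟨Set.mem_iInter₂.1 hx C hC, hxV⟩
        · intro b hb
          rw [Finset.mem_compl, Finset.mem_biUnion]
          rintro ⟨C, hC, hbC⟩
          exact Finset.mem_compl.1 (hb _ ⟨C, hC, rfl⟩) hbC
      · intro hx
        have hx' := hx
        rw [← hslice] at hx'
        refine ⟨Set.mem_iInter₂.2 fun C hC => ?_, hx'.2⟩
        have hsub : (S.biUnion id)ᶜ ⊆ Cᶜ :=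
          Finset.compl_subset_compl.2 (Finset.subset_biUnion_of_mem id hC)
        have hx2 : x ∈ PipeRoot.rootPolytope (PipeRoot.boxGraph Cᶜ) ∩ V := by
          rw [hslice]
          exact convexHull_mono (Set.image_mono (Finset.coe_subset.2 hsub)) hx
        exact hx2.1
    exact ⟨hgraph, hinter.trans hhull.symm, hinter⟩
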